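/- **Conventions.** A multigraph $X$ is finite (loops and multiple edges allowed), with vertex set $V_X$, set of directed edges $\vec E_X$, origin and terminus maps, and a fixed-point-free inversion $e\mapsto \bar e$ of $\vec E_X$ exchanging origin and terminus; the undirected edges are the pairs $\{e,\bar e\}$. A cover is a morphism that is surjective on vertices and maps the directed edges with origin $y$ bijectively onto those with origin the image of $y$, for every vertex $y$; a cover is Galois if its covering transformations act transitively on every fibre. Let $\ell$ be a prime. An abelian $\ell$-tower of connected multigraphs over $X$ is a sequence of covers of connected multigraphs $X=X_0\leftarrow X_1\leftarrow X_2\leftarrow\cdots$ such that, for all $n$, the composite cover $X_n\to X$ is Galois with group of covering transformations isomorphic to $\mathbb Z/\ell^n\mathbb Z$. Let $S\subseteq \vec E_X$ contain exactly one directed edge of each undirected edge, let $\alpha\colon S\to\mathbb Z_\ell$ be a function, extended to $\vec E_X$ by $\alpha(\bar s)=-\alpha(s)$, and let $\alpha_n$ be its reduction modulo $\ell^n$. The derived multigraph $X(\mathbb Z/\ell^n\mathbb Z,S,\alpha_n)$ has vertices $V_X\times\mathbb Z/\ell^n\mathbb Z$ and directed edges $\vec E_X\times\mathbb Z/\ell^n\mathbb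 Z$, where $(e,\sigma)$ goes from $(o(e),\sigma)$ to $(t(e),\sigma+\alpha_n(e))$ and has inverse $(\bar e,\sigma+\alpha_n(e))$. For a commutative ring $R$, let $R[T;\mathbb Z_\ell]$ be the group ring of $\mathbb Z_\ell$ over $R$, written as finite sums $\sum_a\lambda_aT^a$ with $a\in\mathbb Z_\ell$, $\lambda_a\in R$. Let $$f(T)=\det M(T)\in\mathbb Z[T;\mathbb Z_\ell],\qquad M(T)=D-\Bigl(\sum_{s\in S,\ s\colon v\to w}T^{\alpha(s)}+\sum_{s\in S,\ s\colon w\to v}T^{-\alpha(s)}\Bigr)_{v,w\in V_X},$$ where $D$ is the diagonal matrix of valencies (a loop counts twice). Let $p\neq\ell$ be a prime. For $P=\sum_a\lambda_aT^a\in\mathbb Z[T;\mathbb Z_\ell]$ put $\mu(P)=\min_a\operatorname{ord}_p(\lambda_a)$, and for a root of unity $\xi$ of $\ell$-power order put $P(\xi)=\sum_a\lambda_a\xi^a$. Let $\mathfrak m_\infty$ be the maximal ideal of the valuation ring of $\mathbb Q_p(\mu_{\ell^\infty})\subseteq\overline{\mathbb Q}_p$. **Theorem.** Let $\ell\ne p$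 be primes. (1) Let $X$, $S$, $\alpha$ be as above, suppose that $X_n=X(\mathbb Z/\ell^n\mathbb Z,S,\alpha_n)$ is connected for all $n\ge 0$, and let $\kappa_n$ be the number of spanning trees of $X_n$. Then $\mu=\mu(f)$ is finite, and $f=p^\mu g$ with $g\in\mathbb Z[T;\mathbb Z_\ell]$, $\mu(g)=0$. There is a least positive integer $n_0$ such that $g(\xi)\not\equiv0\pmod{\mathfrak m_\infty}$ whenever $\xi$ is a primitive $\ell^i$-th root of unity with $i\ge n_0$, and there is an integer $\nu$ such that $$\operatorname{ord}_p(\kappa_n)=\mu\cdot\ell^n+\nu\qquad\text{for all } n\ge n_0.$$ (2) Let $X=X_0\leftarrow X_1\leftarrow\cdots$ be any abelian $\ell$-tower of connected multigraphs, let $\kappa_n$ be the number of spanning trees of $X_n$, and let $S$ be as above. Then there is a function $\alpha\colon S\to\mathbb Z_\ell$ such that the tower is isomorphic to the tower of the derived multigraphs $X(\mathbb Z/\ell^n\mathbb Z,S,\alpha_n)$, by isomorphisms compatible with the maps of the two towers and with the projections to $X$, and the conclusion of (1) holds for $\kappa_n$ with the generalized polynomial $f$ of this $\alpha$. In particular there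 are integers $n_0,\mu\ge0$ and $\nu$ with $\operatorname{ord}_p(\kappa_n)=\mu\cdot\ell^n+\nu$ for all $n\ge n_0$. -/

import Mathlib

universe u v

/-- A finite multigraph (loops and parallel edges allowed), given by its vertices `V`, its
directed edges `E`, the origin and terminus of a directed edge, and the fixed-point-free
inversion of directed edges. The undirected edges are the pairs `{e, inv e}`. -/
structure Multigraph where
  V : Type u
  E : Type v
  finite_V : Finite V
  finite_E : Finite E
  src : E → V
  tgt : E → V
  inv : E → E
  inv_inv : ∀ e, inv (inv e) = e
  inv_ne : ∀ e, inv e ≠ e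
  src_inv : ∀ e, src (inv e) = tgt e

namespace Multigraph

attribute [instance] Multigraph.finite_V Multigraph.finite_E

noncomputable instance (X : Multigraph.{u, v}) : Fintype X.V := Fintype.ofFinite X.V
noncomputable instance (X : Multigraph.{u, v}) : DecidableEq X.V := Classical.decEq X.V

theorem tgt_inv (X : Multigraph.{u, v}) (e : X.E) : X.tgt (X.inv e) = X.src e := by
  rw [← X.src_inv, X.inv_inv]

/-- `X.IsWalk x w y`: the list `w` of directed edges is a walk from `x` to `y`. -/
def IsWalk (X : Multigraph.{u, v}) : X.V → List X.E → X.V → Prop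
  | x, [], y => x = y
  | x, e :: w, y => X.src e = x ∧ X.IsWalk (X.tgt e) w y

/-- A walk without backtracking. -/
def IsReduced (X : Multigraph.{u, v}) (w : List X.E) : Prop :=
  w.IsChain (fun e e' => e' ≠ X.inv e)

/-- The graph with all the vertices of `X` and the directed edges in `F` is connected. -/
def ConnectedOn (X : Multigraph.{u, v}) (F : Set X.E) : Prop :=
  Nonempty X.V ∧ ∀ x y, ∃ w, X.IsWalk x w y ∧ ∀ e ∈ w, e ∈ F

/-- `F` contains no cycle: a closed walk in `F` without backtracking is empty. -/
def AcyclicOn (X : Multigraph.{u, v}) (F : Set X.E) : Prop :=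
  ∀ x w, X.IsWalk x w x → X.IsReduced w → (∀ e ∈ w, e ∈ F) → w = []

def Connected (X : Multigraph.{u, v}) : Prop := X.ConnectedOn Set.univ

/-- A spanning tree, given by a set `F` of undirected edges, that is, by a set of directed edges
that is stable under inversion. -/
def IsSpanningTree (X : Multigraph.{u, v}) (F : Set X.E) : Prop :=
  (∀ e ∈ F, X.inv e ∈ F) ∧ X.ConnectedOn F ∧ X.AcyclicOn F

/-- The number `κ` of spanning trees. -/
noncomputable def numSpanningTrees (X : Multigraph.{u, v}) : ℕ :=
  {F : Set X.E | X.IsSpanningTree F}.ncard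

/-- The valency of a vertex (a loop counts twice). -/
noncomputable def valency (X : Multigraph.{u, v}) (x : X.V) : ℕ :=
  {e : X.E | X.src e = x}.ncard

/-- Morphisms of multigraphs. -/
@[ext]
structure Hom (Y X : Multigraph.{u, v}) where
  onV : Y.V → X.V
  onE : Y.E → X.E
  src_onE : ∀ e, X.src (onE e) = onV (Y.src e)
  tgt_onE : ∀ e, X.tgt (onE e) = onV (Y.tgt e)
  onE_inv : ∀ e, onE (Y.inv e) = X.inv (onE e)

namespace Hom

def id (X : Multigraph.{u, v}) : Hom X X :=
  ⟨fun x => x, fun e => e, fun _ => rfl, fun _ => rfl, fun _ => rfl⟩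

def comp {Z Y X : Multigraph.{u, v}} (f : Hom Y X) (g : Hom Z Y) : Hom Z X where
  onV := f.onV ∘ g.onV
  onE := f.onE ∘ g.onE
  src_onE e := by simp [f.src_onE, g.src_onE]
  tgt_onE e := by simp [f.tgt_onE, g.tgt_onE]
  onE_inv e := by simp [f.onE_inv, g.onE_inv]

/-- An isomorphism of multigraphs. -/
def IsIso {Y X : Multigraph.{u, v}} (f : Hom Y X) : Prop :=
  Function.Bijective f.onV ∧ Function.Bijective f.onE

/-- A cover: onto on vertices, and for every vertex `y` a bijection from the directed edges with
origin `y` to those with origin the image of `y`. -/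
def IsCover {Y X : Multigraph.{u, v}} (f : Hom Y X) : Prop :=
  Function.Surjective f.onV ∧
    ∀ (y : Y.V) (e : X.E), X.src e = f.onV y → ∃! e' : Y.E, Y.src e' = y ∧ f.onE e' = e

/-- The group of covering transformations of `f : Y → X`: the automorphisms of `Y` over `X`. -/
def deckGroup {Y X : Multigraph.{u, v}} (f : Hom Y X) :
    Subgroup (Equiv.Perm Y.V × Equiv.Perm Y.E) where
  carrier := {σ | (∀ e, Y.src (σ.2 e) = σ.1 (Y.src e)) ∧ (∀ e, Y.tgt (σ.2 e) = σ.1 (Y.tgt e)) ∧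
    (∀ e, σ.2 (Y.inv e) = Y.inv (σ.2 e)) ∧
    (∀ y, f.onV (σ.1 y) = f.onV y) ∧ (∀ e, f.onE (σ.2 e) = f.onE e)}
  one_mem' := by simp
  mul_mem' := by
    rintro σ τ ⟨h1, h2, h3, h4, h5⟩ ⟨k1, k2, k3, k4, k5⟩
    simp_all
  inv_mem' := by
    rintro σ ⟨h1, h2, h3, h4, h5⟩
    refine ⟨fun e => ?_, fun e => ?_, fun e => ?_, fun y => ?_, fun e => ?_⟩
    · apply σ.1.injective
      rw [← h1]
      simp
    · apply σ.1.injective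
      rw [← h2]
      simp
    · apply σ.2.injective
      rw [h3]
      simp
    · rw [← h4]
      simp
    · rw [← h5]
      simp

/-- A Galois cover: the covering transformations act transitively on every fibre. -/
def IsGalois {Y X : Multigraph.{u, v}} (f : Hom Y X) : Prop :=
  f.IsCover ∧ ∀ y y' : Y.V, f.onV y = f.onV y' → ∃ σ ∈ f.deckGroup, σ.1 y = y'

end Hom

/-- A sequence of multigraphs and morphisms `X₀ ← X₁ ← X₂ ← ⋯`. -/
structure Tower where
  graph : ℕ → Multigraph.{u, v}
  map : ∀ n, Hom (graph (n + 1)) (graph n)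

/-- The composite `Xₙ → ⋯ → X₁ → X₀`. -/
def Tower.toBase (T : Tower.{u, v}) : ∀ n, Hom (T.graph n) (T.graph 0)
  | 0 => Hom.id _
  | n + 1 => (T.toBase n).comp (T.map n)

/-- An abelian `ℓ`-tower of connected multigraphs over `X₀`. -/
structure Tower.IsAbelian (ℓ : ℕ) (T : Tower.{u, v}) : Prop where
  connected : ∀ n, (T.graph n).Connected
  cover : ∀ n, (T.map n).IsCover
  galois : ∀ n, (T.toBase n).IsGalois
  group : ∀ n, Nonempty ((T.toBase n).deckGroup ≃* Multiplicative (ZMod (ℓ ^ n)))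

/-- The image `S` of a section of the map from directed edges to undirected edges: `S` contains
exactly one of `e` and `inv e`, for every directed edge `e`. -/
def IsSection (X : Multigraph.{u, v}) (S : Set X.E) : Prop :=
  ∀ e, X.inv e ∈ S ↔ e ∉ S

section Derived

variable {G : Type*} [AddCommGroup G]

open Classical in
/-- The extension of a function `α` on `S` to all directed edges, with `α (inv s) = - α s`. -/
noncomputable def extend (X : Multigraph.{u, v}) {S : Set X.E} (hS : X.IsSection S)
    (α : S → G) (e : X.E) : G :=
  if h : e ∈ S then α ⟨e, h⟩ else - α ⟨X.inv e, (hS e).2 h⟩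

theorem extend_inv (X : Multigraph.{u, v}) {S : Set X.E} (hS : X.IsSection S)
    (α : S → G) (e : X.E) : X.extend hS α (X.inv e) = - X.extend hS α e := by
  unfold extend
  by_cases h : e ∈ S
  · have h' : X.inv e ∉ S := fun k => (hS e).1 k h
    simp [h, h', X.inv_inv]
  · have h' : X.inv e ∈ S := (hS e).2 h
    simp [h, h']

theorem extend_map (X : Multigraph.{u, v}) {S : Set X.E} (hS : X.IsSection S) {H : Type*}
    [AddCommGroup H] (φ : G →+ H) (α : S → G) (e : X.E) :
    X.extend hS (φ ∘ α) e = φ (X.extend hS α e) := by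
  unfold extend
  split_ifs <;> simp

/-- The derived multigraph `X(G, S, α)`: the directed edge `(e, σ)` goes from
`(src e, σ)` to `(tgt e, σ + α e)`, and its inverse is `(inv e, σ + α e)`. -/
noncomputable def derived (X : Multigraph.{u, v}) {G : Type} [AddCommGroup G] [Finite G]
    {S : Set X.E} (hS : X.IsSection S) (α : S → G) : Multigraph.{u, v} where
  V := X.V × G
  E := X.E × G
  finite_V := inferInstance
  finite_E := inferInstance
  src e := (X.src e.1, e.2)
  tgt e := (X.tgt e.1, e.2 + X.extend hS α e.1)
  inv e := (X.inv e.1, e.2 + X.extend hS α e.1)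
  inv_inv e := by simp [X.inv_inv, extend_inv]
  inv_ne e h := X.inv_ne e.1 (congrArg Prod.fst h)
  src_inv e := by simp [X.src_inv]

end Derived

section DerivedTower

variable {ℓ : ℕ} [Fact ℓ.Prime]

/-- The reduction `αₙ : S → ℤ/ℓⁿℤ` of `α : S → ℤ_ℓ`. -/
noncomputable def voltage {E : Type*} {S : Set E} (α : S → ℤ_[ℓ]) (n : ℕ) : S → ZMod (ℓ ^ n) :=
  (PadicInt.toZModPow n).toAddMonoidHom ∘ α

/-- The map `X(ℤ/ℓⁿ⁺¹ℤ, S, αₙ₊₁) → X(ℤ/ℓⁿℤ, S, αₙ)`. -/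
noncomputable def derivedMap (X : Multigraph.{u, v}) {S : Set X.E} (hS : X.IsSection S)
    (α : S → ℤ_[ℓ]) (n : ℕ) :
    Hom (X.derived hS (voltage α (n + 1))) (X.derived hS (voltage α n)) where
  onV x := (x.1, ZMod.castHom (pow_dvd_pow ℓ n.le_succ) (ZMod (ℓ ^ n)) x.2)
  onE e := (e.1, ZMod.castHom (pow_dvd_pow ℓ n.le_succ) (ZMod (ℓ ^ n)) e.2)
  src_onE _ := rfl
  tgt_onE e := by
    refine Prod.ext rfl ?_
    simp only [derived, voltage, extend_map, map_add, ZMod.castHom_apply]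
    simp
  onE_inv e := by
    refine Prod.ext rfl ?_
    simp only [derived, voltage, extend_map, map_add, ZMod.castHom_apply]
    simp

/-- The tower of the derived multigraphs `X(ℤ/ℓⁿℤ, S, αₙ)`. -/
noncomputable def derivedTower (X : Multigraph.{u, v}) {S : Set X.E} (hS : X.IsSection S)
    (α : S → ℤ_[ℓ]) : Tower.{u, v} where
  graph n := X.derived hS (voltage α n)
  map := X.derivedMap hS α

/-- The projection `X(ℤ/ℓⁿℤ, S, αₙ) → X`. -/
noncomputable def derivedToBase (X : Multigraph.{u, v}) {S : Set X.E} (hS : X.IsSection S)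
    (α : S → ℤ_[ℓ]) (n : ℕ) : Hom ((X.derivedTower hS α).graph n) X where
  onV := Prod.fst
  onE := Prod.fst
  src_onE _ := rfl
  tgt_onE _ := rfl
  onE_inv _ := rfl

/-- The tower `T` is isomorphic, over its base `X`, to the tower of the derived multigraphs
`X(ℤ/ℓⁿℤ, S, αₙ)`. -/
def Tower.IsoDerived (T : Tower.{u, v}) {S : Set (T.graph 0).E} (hS : (T.graph 0).IsSection S)
    (α : S → ℤ_[ℓ]) : Prop :=
  ∃ φ : ∀ n, Hom (((T.graph 0).derivedTower hS α).graph n) (T.graph n),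
    (∀ n, (φ n).IsIso) ∧
    (∀ n, (T.map n).comp (φ (n + 1)) = (φ n).comp (((T.graph 0).derivedTower hS α).map n)) ∧
    (∀ n, (T.toBase n).comp (φ n) = (T.graph 0).derivedToBase hS α n)

/-- The matrix `M(T)` over the ring `ℤ[T; ℤ_ℓ]` of generalized polynomials; the monomial `T ^ a`
is `AddMonoidAlgebra.single a 1`. -/
noncomputable def genMatrix (X : Multigraph.{u, v}) {S : Set X.E} (α : S → ℤ_[ℓ]) :
    Matrix X.V X.V (AddMonoidAlgebra ℤ ℤ_[ℓ]) :=
  Matrix.diagonal (fun x => (X.valency x : AddMonoidAlgebra ℤ ℤ_[ℓ])) -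
    Matrix.of fun x y =>
      ((∑ᶠ s : {s : S // X.src s = x ∧ X.tgt s = y}, AddMonoidAlgebra.single (α s) (1 : ℤ)) +
        ∑ᶠ s : {s : S // X.src s = y ∧ X.tgt s = x}, AddMonoidAlgebra.single (-α s) (1 : ℤ))

/-- `f(T) = det M(T)`. -/
noncomputable def genPoly (X : Multigraph.{u, v}) {S : Set X.E} (α : S → ℤ_[ℓ]) :
    AddMonoidAlgebra ℤ ℤ_[ℓ] :=
  (X.genMatrix α).det

end DerivedTower

end Multigraph

namespace GenPoly

/-- `μ(P)`: the minimum of the `p`-adic valuations of the coefficients of `P` (`⊤` for `P = 0`). -/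
noncomputable def mu (p : ℕ) {A : Type*} (P : AddMonoidAlgebra ℤ A) : ℕ∞ :=
  ⨅ a : A, emultiplicity (p : ℤ) (P.coeff a)

/-- The value `P(ξ) = ∑ λ_a ξ ^ a` at an element `ξ` with `ξ ^ (ℓ ^ n) = 1`, where `ξ ^ a` is
`ξ` to the power `a mod ℓ ^ n`; it does not depend on the choice of such an `n`. -/
noncomputable def eval {ℓ : ℕ} [Fact ℓ.Prime] {R : Type*} [CommRing R] (n : ℕ) (ξ : R)
    (P : AddMonoidAlgebra ℤ ℤ_[ℓ]) : R :=
  P.coeff.sum fun a c => (c : R) * ξ ^ (PadicInt.toZModPow n a).val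

/-- The field `ℚ_p(ξ_{ℓ^∞})` generated over `ℚ_p` by all roots of unity of `ℓ`-power order. -/
noncomputable def cycField (p ℓ : ℕ) [Fact p.Prime] : IntermediateField ℚ_[p] (PadicAlgCl p) :=
  IntermediateField.adjoin ℚ_[p] {ξ | ∃ n : ℕ, ξ ^ ℓ ^ n = 1}

/-- The valuation ring `O_∞` of `ℚ_p(ξ_{ℓ^∞})`. -/
noncomputable def cycInt (p ℓ : ℕ) [Fact p.Prime] : ValuationSubring (cycField p ℓ) :=
  ((NormedField.valuation (K := PadicAlgCl p)).comap
    (algebraMap (cycField p ℓ) (PadicAlgCl p))).valuationSubring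

/-- For all `i ≥ N` and all primitive `ℓ ^ i`-th roots of unity `ξ`, `g(ξ)` is not congruent to
`0` modulo the maximal ideal `𝔪_∞` of `O_∞`. -/
def NoZerosFrom (p : ℕ) {ℓ : ℕ} [Fact p.Prime] [Fact ℓ.Prime] (g : AddMonoidAlgebra ℤ ℤ_[ℓ])
    (N : ℕ) : Prop :=
  ∀ i, N ≤ i → ∀ ξ : cycInt p ℓ, IsPrimitiveRoot ξ (ℓ ^ i) →
    eval i ξ g ∉ IsLocalRing.maximalIdeal (cycInt p ℓ)

/-- The growth law for a sequence `κ`, controlled by a generalized polynomial `f`: `μ = μ(f)` is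
finite, `f = p ^ μ * g` with `μ(g) = 0`, there is a least positive integer `n₀` from which on `g`
has no zeros modulo `𝔪_∞`, and `ord_p (κ n) = μ * ℓ ^ n + ν` for all `n ≥ n₀`. -/
def Growth (p : ℕ) {ℓ : ℕ} [Fact p.Prime] [Fact ℓ.Prime] (f : AddMonoidAlgebra ℤ ℤ_[ℓ])
    (κ : ℕ → ℕ) : Prop :=
  ∃ (μ : ℕ) (g : AddMonoidAlgebra ℤ ℤ_[ℓ]),
    mu p f = μ ∧ f = (p : AddMonoidAlgebra ℤ ℤ_[ℓ]) ^ μ * g ∧ mu p g = 0 ∧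
    ∃ n₀ : ℕ, IsLeast {N : ℕ | 1 ≤ N ∧ NoZerosFrom p g N} n₀ ∧
      ∃ ν : ℤ, ∀ n, n₀ ≤ n → (padicValNat p (κ n) : ℤ) = μ * (ℓ : ℤ) ^ n + ν

end GenPoly

/-! Write J for the all-ones matrix. The matrix-tree theorem in the form det(L + J) = |V|² κ
(`det_laplacian_add_one`) turns spanning trees into a determinant. For a derived multigraph, L + J
is a matrix of convolution operators over ℤ/ℓⁿℤ. The finite Fourier transform splits its determinant
into a product over the ℓⁿ-th roots of unity ξ, whose factor at ξ ≠ 1 is the determinant of a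
twisted Laplacian, that is f(ξ) (`prod_det_twistedLaplacian`, `eval_genPoly`). Going from n to n + 1
only adds the primitive roots, so ℓ κₙ₊₁ = κₙ ∏ f(ξ) over primitive ξ of order ℓⁿ⁺¹
(`numSpanningTrees_derived_succ`). As κ₁ ≠ 0, also f ≠ 0.

Write f = p^μ g. If g(ξ) is a unit modulo 𝔪_∞ at all these ξ, each of the ℓⁿ⁺¹ - ℓⁿ factors has
absolute value p^(-μ), and ord_p κₙ grows by μ(ℓⁿ⁺¹ - ℓⁿ), because ℓ is a p-adic unit. So the growth
law reduces to showing that g has zeros in characteristic p at only finitely many levels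
(`exists_forall_eval_ne_zero`). A zero ξ there propagates under Frobenius to all ξζᵗ, where ζ is a
power of ξ whose order ℓᵐ is large enough to separate the exponents of g. A Vandermonde argument
then kills every coefficient of g modulo p.

For an arbitrary abelian tower, the identifications of the covering groups with ℤ/ℓⁿℤ and the lifts
of the base vertices can be chosen compatibly. Comparing the end of the lift of an edge with the
chosen lift of its terminus gives compatible elements of ℤ/ℓⁿℤ, hence the function α
(`IsAbelian.exists_isoDerived`). Isomorphic multigraphs have equally many spanning trees, so the
first part applies. -/

namespace Multigraph

/-! ### Walks, cycles and the existence of spanning trees -/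

section Walks

variable {X : Multigraph.{u, v}}

theorem isWalk_append {x z : X.V} {w w' : List X.E} :
    X.IsWalk x (w ++ w') z ↔ ∃ y, X.IsWalk x w y ∧ X.IsWalk y w' z := by
  induction w generalizing x with
  | nil => simp [IsWalk]
  | cons e w ih => simp [IsWalk, ih, and_assoc]

theorem IsWalk.reverse {x y : X.V} {w : List X.E} (h : X.IsWalk x w y) :
    X.IsWalk y (w.map X.inv).reverse x := by
  induction w generalizing x with
  | nil => exact Eq.symm h
  | cons e w ih =>
    rw [List.map_cons, List.reverse_cons, isWalk_append]
    exact ⟨_, ih h.2, X.src_inv e, by simpa [IsWalk, X.tgt_inv] using h.1⟩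

/-- Two vertices are joined in `F` if there is a walk in `F` from one to the other. -/
def Joined (X : Multigraph.{u, v}) (F : Set X.E) (x y : X.V) : Prop :=
  ∃ w, X.IsWalk x w y ∧ ∀ e ∈ w, e ∈ F

theorem Joined.refl (F : Set X.E) (x : X.V) : X.Joined F x x := ⟨[], rfl, by simp⟩

theorem Joined.trans {F : Set X.E} {x y z : X.V} (h : X.Joined F x y) (h' : X.Joined F y z) :
    X.Joined F x z := by
  obtain ⟨w, hw, hF⟩ := h
  obtain ⟨w', hw', hF'⟩ := h'
  refine ⟨w ++ w', isWalk_append.2 ⟨y, hw, hw'⟩, fun e he => ?_⟩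
  rcases List.mem_append.1 he with he | he
  exacts [hF e he, hF' e he]

theorem Joined.symm {F : Set X.E} (hF : ∀ e ∈ F, X.inv e ∈ F) {x y : X.V}
    (h : X.Joined F x y) : X.Joined F y x := by
  obtain ⟨w, hw, hwF⟩ := h
  refine ⟨_, hw.reverse, fun e he => ?_⟩
  simp only [List.mem_reverse, List.mem_map] at he
  obtain ⟨e', he', rfl⟩ := he
  exact hF _ (hwF _ he')

theorem Joined.of_mem {F : Set X.E} {e : X.E} (he : e ∈ F) :
    X.Joined F (X.src e) (X.tgt e) := ⟨[e], ⟨rfl, rfl⟩, by simpa⟩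

/-- A vertex function that is constant along the edges of `F` is constant along walks in `F`. -/
theorem Joined.apply_eq {F : Set X.E} {A : Type*} {f : X.V → A}
    (hf : ∀ e ∈ F, f (X.src e) = f (X.tgt e)) {x y : X.V} (h : X.Joined F x y) : f x = f y := by
  obtain ⟨w, hw, hwF⟩ := h
  induction w generalizing x with
  | nil => exact congrArg f hw
  | cons e w ih =>
    rw [← hw.1, hf e (hwF e (by simp))]
    exact ih hw.2 fun e' he' => hwF e' (by simp [he'])

/-- `F` without the undirected edge `{e, inv e}`. -/
def removeEdge (X : Multigraph.{u, v}) (F : Set X.E) (e : X.E) : Set X.E := F \ {e, X.inv e}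

theorem mem_removeEdge {F : Set X.E} {e e' : X.E} :
    e' ∈ X.removeEdge F e ↔ e' ∈ F ∧ e' ≠ e ∧ e' ≠ X.inv e := by
  simp [removeEdge]

theorem inv_injective (X : Multigraph.{u, v}) : Function.Injective X.inv :=
  Function.LeftInverse.injective X.inv_inv

theorem inv_mem_removeEdge {F : Set X.E} (hF : ∀ e ∈ F, X.inv e ∈ F) (e : X.E) :
    ∀ e' ∈ X.removeEdge F e, X.inv e' ∈ X.removeEdge F e := by
  intro e' he'
  rw [mem_removeEdge] at he' ⊢
  refine ⟨hF _ he'.1, fun h => he'.2.2 ?_, fun h => he'.2.1 (X.inv_injective h)⟩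
  rw [← h, X.inv_inv]

/-- Every passage through the removed edge, in either direction, is rerouted along the given detour.
-/
theorem ConnectedOn.removeEdge {F : Set X.E} (hF : ∀ e ∈ F, X.inv e ∈ F)
    (h : X.ConnectedOn F) {e : X.E}
    (he : X.Joined (X.removeEdge F e) (X.tgt e) (X.src e)) :
    X.ConnectedOn (X.removeEdge F e) := by
  refine ⟨h.1, fun x y => ?_⟩
  obtain ⟨w, hw, hwF⟩ := h.2 x y
  change X.Joined _ x y
  induction w generalizing x with
  | nil => rw [show x = y from hw]; exact .refl _ _
  | cons e' w ih =>
    rw [← hw.1]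
    refine Joined.trans ?_ (ih _ hw.2 fun e he => hwF e (by simp [he]))
    have hs := he.symm (inv_mem_removeEdge hF e)
    by_cases h1 : e' = e
    · rwa [h1]
    by_cases h2 : e' = X.inv e
    · rwa [h2, X.src_inv, X.tgt_inv]
    exact .of_mem (mem_removeEdge.2 ⟨hwF e' (by simp), h1, h2⟩)

theorem Joined.exists_isReduced {F : Set X.E} {x y : X.V} (h : X.Joined F x y) :
    ∃ w, X.IsWalk x w y ∧ X.IsReduced w ∧ ∀ e ∈ w, e ∈ F := by
  obtain ⟨w, hw, hwF⟩ := h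
  induction w generalizing x with
  | nil => exact ⟨[], hw, .nil, by simp⟩
  | cons e w ih =>
    obtain ⟨w', h1, h2, h3⟩ := ih hw.2 fun e he => hwF e (by simp [he])
    cases w' with
    | nil => exact ⟨[e], ⟨hw.1, h1⟩, by simp [IsReduced], by simpa using hwF e (by simp)⟩
    | cons e' w' =>
      by_cases he : e' = X.inv e
      · refine ⟨w', ?_, ?_, fun a ha => h3 a (by simp [ha])⟩
        · have := h1.2
          rwa [he, X.tgt_inv, hw.1] at this
        · exact List.IsChain.tail h2
      · refine ⟨e :: e' :: w', ⟨hw.1, h1⟩, ?_, ?_⟩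
        · exact List.IsChain.cons_cons he h2
        · intro a ha
          rcases List.mem_cons.1 ha with rfl | ha
          exacts [hwF _ (by simp), h3 a ha]

/-- A reduced walk from the end of `e` back to its start that avoids `e` and its inverse, preceded
by `e`, would be a nonempty reduced closed walk. -/
theorem AcyclicOn.not_connectedOn_removeEdge {F : Set X.E} (h : X.AcyclicOn F) {e : X.E}
    (he : e ∈ F) : ¬ X.ConnectedOn (X.removeEdge F e) := by
  intro hc
  obtain ⟨w, h1, h2, h3⟩ := Joined.exists_isReduced (hc.2 (X.tgt e) (X.src e))
  refine List.cons_ne_nil e w (h (X.src e) (e :: w) ⟨rfl, h1⟩ ?_ ?_)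
  · cases w with
    | nil => simp [IsReduced]
    | cons e' w =>
      exact List.IsChain.cons_cons (mem_removeEdge.1 (h3 e' (by simp))).2.2 h2
  · intro a ha
    rcases List.mem_cons.1 ha with rfl | ha
    exacts [he, (h3 a ha).1]

theorem exists_first_mem {A : Type*} (P : A → Prop) (w : List A) :
    (∀ a ∈ w, ¬ P a) ∨ ∃ u a v, w = u ++ a :: v ∧ (∀ b ∈ u, ¬ P b) ∧ P a := by
  induction w with
  | nil => simp
  | cons b w ih =>
    by_cases hb : P b
    · exact .inr ⟨[], b, w, rfl, by simp, hb⟩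
    rcases ih with ih | ⟨u, a, v, rfl, h1, h2⟩
    · exact .inl (by simpa [hb] using ih)
    · exact .inr ⟨b :: u, a, v, rfl, by simpa [hb] using h1, h2⟩

/-- A shortest cycle through `e` supplies a detour around `e`, contradicting minimality. The
induction on length deals with walks that meet `e` again. -/
theorem ConnectedOn.acyclicOn {F : Set X.E} (hF : ∀ e ∈ F, X.inv e ∈ F)
    (h : X.ConnectedOn F) (hmin : ∀ e ∈ F, ¬ X.ConnectedOn (X.removeEdge F e)) :
    X.AcyclicOn F := by
  suffices ∀ n x w, w.length = n → X.IsWalk x w x → X.IsReduced w → (∀ e ∈ w, e ∈ F) → w = [] from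
    fun x w => this _ x w rfl
  intro n
  induction n using Nat.strong_induction_on with
  | _ n ih =>
    intro x w hn hw hr hwF
    cases w with
    | nil => rfl
    | cons e w =>
      exfalso
      obtain ⟨rfl, hw⟩ := hw
      have he : e ∈ F := hwF e (by simp)
      have hsub : ∀ a ∈ w, a ∈ F := fun a ha => hwF a (by simp [ha])
      rcases exists_first_mem (fun a => a = e ∨ a = X.inv e) w with h1 | ⟨u, a, t, rfl, h1, h2⟩
      · refine hmin e he (h.removeEdge hF ⟨w, hw, fun a ha => mem_removeEdge.2 ⟨hsub a ha, ?_⟩⟩)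
        simpa using h1 a ha
      · obtain ⟨y, hu, rfl, -⟩ := isWalk_append.1 hw
        rcases h2 with rfl | rfl
        · refine hmin a he (h.removeEdge hF ⟨u, hu, fun b hb => mem_removeEdge.2 ⟨?_, ?_⟩⟩)
          · exact hsub b (by simp [hb])
          · simpa using h1 b hb
        -- The segment before the inverse edge is a shorter reduced closed walk, hence empty, so the
        -- walk backtracks immediately.
        · rw [X.src_inv] at hu
          have hu0 : u = [] := by
            refine ih u.length ?_ _ u rfl hu ?_ fun b hb => hsub b (by simp [hb])
            · rw [← hn]; simp
            · exact (List.isChain_append.1 (List.IsChain.tail hr)).1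
          subst hu0
          simp [IsReduced] at hr

theorem Connected.exists_isSpanningTree (h : X.Connected) : ∃ F, X.IsSpanningTree F := by
  classical
  let C : Set (Set X.E) := {F | (∀ e ∈ F, X.inv e ∈ F) ∧ X.ConnectedOn F}
  have hC : C.Nonempty := ⟨Set.univ, by simp, h⟩
  obtain ⟨F, hF, hmin⟩ := Set.exists_min_image C Set.ncard (Set.toFinite C) hC
  refine ⟨F, hF.1, hF.2, hF.2.acyclicOn hF.1 fun e he hc => ?_⟩
  refine absurd (hmin _ ⟨inv_mem_removeEdge hF.1 e, hc⟩) (not_le.2 ?_)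
  refine Set.ncard_lt_ncard ⟨Set.sdiff_subset, fun hh => ?_⟩
  exact (mem_removeEdge.1 (hh he)).2.1 rfl

theorem Connected.numSpanningTrees_ne_zero (h : X.Connected) : X.numSpanningTrees ≠ 0 := by
  obtain ⟨F, hF⟩ := h.exists_isSpanningTree
  exact (Set.ncard_ne_zero_of_mem (s := {F : Set X.E | X.IsSpanningTree F}) hF)

end Walks

end Multigraph

/-! ### Cauchy–Binet and divisibility of determinants -/

namespace Matrix

variable {m n R : Type*} [Fintype m] [Fintype n] [DecidableEq n] [CommRing R]

theorem det_mul_eq_sum_det_submatrix (A : Matrix n m R) (B : Matrix m n R) :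
    (A * B).det = ∑ f : n → m, (∏ i, B (f i) i) * (A.submatrix id f).det := by
  classical
  simp only [det_apply', mul_apply, Finset.prod_univ_sum, Fintype.piFinset_univ, Finset.mul_sum]
  rw [Finset.sum_comm]
  refine Finset.sum_congr rfl fun f _ => Finset.sum_congr rfl fun σ _ => ?_
  rw [Finset.prod_mul_distrib]
  simp only [submatrix_apply, id]
  ring

/-- A symmetric form of the Cauchy–Binet formula. -/
theorem sum_det_submatrix_sq (A : Matrix n m R) :
    ∑ f : n → m, (A.submatrix id f).det ^ 2 =
      (Fintype.card n).factorial * (A * A.transpose).det := by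
  -- Expand one of the two equal determinants by the Leibniz formula. Reindexing the sum over `f` by
  -- σ permutes the columns of the other one, and its sign cancels that of the term, so all σ
  -- contribute equally.
  have key : ∀ σ : Equiv.Perm n,
      ∑ f : n → m, ((Equiv.Perm.sign σ : ℤ) : R) * (∏ i, A (σ i) (f i)) *
        (A.submatrix id f).det = (A * A.transpose).det := by
    intro σ
    rw [det_mul_eq_sum_det_submatrix, ← (Equiv.arrowCongr σ (Equiv.refl m)).symm.sum_comp]
    refine Finset.sum_congr rfl fun f _ => ?_
    have h1 : (A.submatrix id (f ∘ σ)).det =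
        ((Equiv.Perm.sign σ : ℤ) : R) * (A.submatrix id f).det :=
      det_permute' σ (A.submatrix id f)
    have h2 : ∏ i, A (σ i) (f (σ i)) = ∏ i, A i (f i) :=
      Equiv.prod_comp σ fun i => A i (f i)
    have h3 : ((Equiv.Perm.sign σ : ℤ) : R) * ((Equiv.Perm.sign σ : ℤ) : R) = 1 := by
      rw [← Int.cast_mul, ← Units.val_mul, Int.units_mul_self]
      simp
    change ((Equiv.Perm.sign σ : ℤ) : R) * (∏ i, A (σ i) (f (σ i))) *
      (A.submatrix id (f ∘ σ)).det = (∏ i, A i (f i)) * (A.submatrix id f).det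
    rw [h1, h2]
    linear_combination (∏ i, A i (f i)) * (A.submatrix id f).det * h3
  calc ∑ f : n → m, (A.submatrix id f).det ^ 2
      = ∑ f : n → m, ∑ σ : Equiv.Perm n, ((Equiv.Perm.sign σ : ℤ) : R) *
          (∏ i, A (σ i) (f i)) * (A.submatrix id f).det := by
        refine Finset.sum_congr rfl fun f _ => ?_
        rw [← Finset.sum_mul, sq]
        congr 1
        rw [det_apply']
        rfl
    _ = ∑ σ : Equiv.Perm n, (A * A.transpose).det := by
        rw [Finset.sum_comm]
        exact Finset.sum_congr rfl fun σ _ => key σ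
    _ = _ := by simp [Fintype.card_perm]

/-- If the columns of `A` are linear combinations of those of `B` then `det B ∣ det A`. -/
theorem det_dvd_det_of_col_mem_span (A B : Matrix n n R)
    (h : ∀ j, A.col j ∈ Submodule.span R (Set.range B.col)) : B.det ∣ A.det := by
  simp only [Submodule.mem_span_range_iff_exists_fun] at h
  choose c hc using h
  have : A = B * Matrix.of fun i j => c j i := by
    ext i j
    have := congrFun (hc j) i
    simp only [Finset.sum_apply, Pi.smul_apply, smul_eq_mul, col_apply] at this
    rw [← this, mul_apply]
    exact Finset.sum_congr rfl fun k _ => by simp [mul_comm]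
  rw [this, det_mul]
  exact dvd_mul_right _ _

end Matrix

/-! ### The Laplacian, the incidence matrix and edge counts -/

namespace Multigraph

variable {X : Multigraph.{u, v}}

noncomputable instance (X : Multigraph.{u, v}) : Fintype X.E := Fintype.ofFinite X.E

open scoped Classical in
theorem IsSection.sum_eq {S : Set X.E} (hS : X.IsSection S) {A : Type*} [AddCommMonoid A]
    (f : X.E → A) : ∑ e, f e = ∑ s : S, (f s + f (X.inv s)) := by
  have hb : Function.Bijective (Sum.elim (fun s : S => (s : X.E)) fun s : S => X.inv s) := by
    constructor
    · rintro (⟨s, hs⟩ | ⟨s, hs⟩) (⟨t, ht⟩ | ⟨t, ht⟩) h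
      · simp_all
      · simp only [Sum.elim_inl, Sum.elim_inr] at h
        exact absurd ht ((hS t).1 (h ▸ hs))
      · simp only [Sum.elim_inl, Sum.elim_inr] at h
        exact absurd hs ((hS s).1 (h ▸ ht))
      · simpa using X.inv_injective h
    · intro e
      by_cases he : e ∈ S
      · exact ⟨.inl ⟨e, he⟩, rfl⟩
      · exact ⟨.inr ⟨X.inv e, (hS e).2 he⟩, X.inv_inv e⟩
  rw [← hb.sum_comp, Fintype.sum_sum_type, Finset.sum_add_distrib]
  rfl

/-- The Laplacian matrix. -/
noncomputable def laplacian (X : Multigraph.{u, v}) : Matrix X.V X.V ℤ :=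
  Matrix.of fun x y => (if x = y then (X.valency x : ℤ) else 0) -
    ({e | X.src e = x ∧ X.tgt e = y}.ncard : ℤ)

theorem ite_valency_eq_sum {R : Type*} [Ring R] (X : Multigraph.{u, v}) (x y : X.V) :
    (if x = y then (X.valency x : R) else 0) =
      ∑ e, (if x = X.src e then (1 : R) else 0) * (if y = X.src e then 1 else 0) := by
  classical
  split_ifs with h
  · subst h
    rw [valency, Set.ncard_eq_toFinset_card', Finset.card_eq_sum_ones]
    push_cast
    rw [Set.toFinset_ofPred, Finset.sum_filter]
    refine Finset.sum_congr rfl fun e _ => ?_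
    by_cases h : X.src e = x
    · simp [h]
    · simp [h, Ne.symm h]
  · symm
    refine Finset.sum_eq_zero fun e _ => ?_
    split_ifs with h1 h2 <;> simp_all

theorem laplacian_apply (X : Multigraph.{u, v}) (x y : X.V) :
    X.laplacian x y = ∑ e, (if x = X.src e then (1 : ℤ) else 0) *
      ((if y = X.src e then 1 else 0) - (if y = X.tgt e then 1 else 0)) := by
  classical
  have h2 : ({e | X.src e = x ∧ X.tgt e = y}.ncard : ℤ) =
      ∑ e, (if x = X.src e then (1 : ℤ) else 0) * (if y = X.tgt e then 1 else 0) := by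
    rw [Set.ncard_eq_toFinset_card', Finset.card_eq_sum_ones]
    push_cast
    rw [Set.toFinset_ofPred, Finset.sum_filter]
    refine Finset.sum_congr rfl fun e _ => ?_
    rw [ite_zero_mul_ite_zero, mul_one]
    simp only [eq_comm]
  rw [laplacian, Matrix.of_apply, ite_valency_eq_sum, h2, ← Finset.sum_sub_distrib]
  exact Finset.sum_congr rfl fun e _ => by ring

/-- The incidence matrix with respect to `S`, with a column of ones added. -/
noncomputable def incidence (X : Multigraph.{u, v}) (S : Set X.E) : Matrix X.V (Option S) ℤ :=
  Matrix.of fun x o => o.elim 1 fun s =>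
    (if x = X.src s then 1 else 0) - (if x = X.tgt s then 1 else 0)

open scoped Classical in
theorem incidence_mul_transpose {S : Set X.E} (hS : X.IsSection S) :
    X.incidence S * (X.incidence S).transpose = X.laplacian + Matrix.of fun _ _ => 1 := by
  ext x y
  rw [Matrix.mul_apply, Fintype.sum_option, Matrix.add_apply, laplacian_apply, hS.sum_eq, add_comm]
  simp only [incidence, Matrix.of_apply, Matrix.transpose_apply, Option.elim, X.src_inv, X.tgt_inv,
    mul_one]
  congr 1
  exact Finset.sum_congr rfl fun e _ => by ring

/-- Connectedness as a statement of linear algebra. For the converse, test with the indicator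
function of the vertices joined to `x`. -/
theorem connectedOn_iff [Nonempty X.V] {S F : Set X.E} (hS : X.IsSection S)
    (hF : ∀ e ∈ F, X.inv e ∈ F) :
    X.ConnectedOn F ↔ ∀ f : X.V → ℚ, (∀ s : S, (s : X.E) ∈ F → f (X.src s) = f (X.tgt s)) →
      ∀ x y, f x = f y := by
  classical
  constructor
  · intro h f hf x y
    refine Joined.apply_eq (F := F) (fun e he => ?_) (h.2 x y)
    by_cases heS : e ∈ S
    · exact hf ⟨e, heS⟩ he
    · have := hf ⟨X.inv e, (hS e).2 heS⟩ (hF e he)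
      rw [X.src_inv, X.tgt_inv] at this
      exact this.symm
  · intro h
    refine ⟨inferInstance, fun x y => ?_⟩
    have := h (fun z => if X.Joined F x z then 1 else 0) (fun s hs => ?_) x y
    · simp only [Joined.refl, if_true] at this
      by_contra hc
      rw [if_neg (show ¬ X.Joined F x y from hc)] at this
      exact one_ne_zero this
    · have : X.Joined F x (X.src s) ↔ X.Joined F x (X.tgt s) :=
        ⟨fun h => h.trans (.of_mem hs), fun h => h.trans ((Joined.of_mem hs).symm hF)⟩
      simp only [this]

/-- A function is determined by its value at `x₀` and its differences along the edges of `F`, so the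
dimensions compare. -/
theorem ConnectedOn.card_le {S F : Set X.E} (hS : X.IsSection S) (hF : ∀ e ∈ F, X.inv e ∈ F)
    (h : X.ConnectedOn F) : Nat.card X.V ≤ {s : S | (s : X.E) ∈ F}.ncard + 1 := by
  classical
  have := h.1
  obtain ⟨x₀⟩ := h.1
  by_contra! hlt
  let D : (X.V → ℚ) →ₗ[ℚ] (Option {s : S // (s : X.E) ∈ F} → ℚ) :=
    LinearMap.pi fun o => o.elim (LinearMap.proj (R := ℚ) (φ := fun _ => ℚ) x₀) fun s =>
      LinearMap.proj (R := ℚ) (φ := fun _ => ℚ) (X.src s) - LinearMap.proj (X.tgt s)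
  have hD : LinearMap.ker D ≠ ⊥ := by
    refine LinearMap.ker_ne_bot_of_finrank_lt ?_
    rw [Module.finrank_pi, Module.finrank_pi, Fintype.card_option, ← Nat.card_eq_fintype_card,
      ← Nat.card_eq_fintype_card]
    exact hlt
  obtain ⟨f, hf, hf0⟩ := (Submodule.ne_bot_iff _).1 hD
  rw [LinearMap.mem_ker] at hf
  refine hf0 (funext fun x => ?_)
  have h0 : f x₀ = 0 := congrFun hf none
  rw [(connectedOn_iff hS hF).1 h f (fun s hs => ?_) x x₀, h0]
  · rfl
  · exact sub_eq_zero.1 (congrFun hf (some ⟨s, hs⟩))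

/-- With this many edges there is a nonzero flow `c` without sources. An edge carrying flow is
redundant: the pairing of `c` with the differences of `f` vanishes, so if `f` is constant along all
other edges it is constant along this one too. -/
theorem ConnectedOn.exists_removeEdge {S F : Set X.E} (hS : X.IsSection S)
    (hF : ∀ e ∈ F, X.inv e ∈ F) (h : X.ConnectedOn F)
    (hlt : Nat.card X.V < {s : S | (s : X.E) ∈ F}.ncard + 1) :
    ∃ e ∈ F, X.ConnectedOn (X.removeEdge F e) := by
  classical
  have := h.1
  obtain ⟨x₀⟩ := h.1
  let b : X.V → {s : S // (s : X.E) ∈ F} → ℚ := fun x s =>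
    (if x = X.src s then 1 else 0) - (if x = X.tgt s then 1 else 0)
  let D : ({s : S // (s : X.E) ∈ F} → ℚ) →ₗ[ℚ] ({x : X.V // x ≠ x₀} → ℚ) :=
    LinearMap.pi fun x => ∑ s, b x s • LinearMap.proj s
  have hD : LinearMap.ker D ≠ ⊥ := by
    refine LinearMap.ker_ne_bot_of_finrank_lt ?_
    have h1 : Fintype.card {s : S // (s : X.E) ∈ F} = {s : S | (s : X.E) ∈ F}.ncard := by
      rw [← Nat.card_eq_fintype_card]; rfl
    rw [Module.finrank_pi, Module.finrank_pi, h1, Fintype.card_subtype_compl,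
      Fintype.card_subtype_eq, ← Nat.card_eq_fintype_card]
    have := Nat.card_pos (α := X.V)
    omega
  obtain ⟨c, hc, hc0⟩ := (Submodule.ne_bot_iff _).1 hD
  rw [LinearMap.mem_ker] at hc
  have hsum : ∀ s, ∑ x, b x s = 0 := by simp [b]
  have hne : ∀ x ≠ x₀, ∑ s, b x s * c s = 0 := by
    intro x hx
    simpa [D] using congrFun hc ⟨x, hx⟩
  -- Conservation at `x₀` follows from that at the other vertices, since the columns of `b` sum to
  -- zero. Omitting it gains the one dimension that is needed.
  have hall : ∀ x, ∑ s, b x s * c s = 0 := by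
    intro x
    by_cases hx : x = x₀
    · have h1 : ∑ y, ∑ s, b y s * c s = 0 := by
        rw [Finset.sum_comm]
        simp [← Finset.sum_mul, hsum]
      rw [← Finset.add_sum_erase _ _ (Finset.mem_univ x), Finset.sum_eq_zero (s := Finset.erase _ _),
        add_zero] at h1
      · exact h1
      · intro y hy
        exact hne y (hx ▸ (Finset.mem_erase.1 hy).1)
    · exact hne x hx
  obtain ⟨s₀, hs₀⟩ := Function.ne_iff.1 hc0
  refine ⟨s₀, s₀.2, (connectedOn_iff hS (inv_mem_removeEdge hF _)).2 fun f hf => ?_⟩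
  refine (connectedOn_iff hS hF).1 h f fun s hs => ?_
  have hother : ∀ s : S, (s : X.E) ∈ F → s ≠ s₀.1 → f (X.src s) = f (X.tgt s) := by
    intro s hs hss
    refine hf s (mem_removeEdge.2 ⟨hs, fun h => hss (Subtype.ext h), fun h => ?_⟩)
    exact (hS s₀.1).1 (h ▸ s.2) s₀.1.2
  by_cases hss : s = s₀.1
  · subst hss
    have h1 : ∑ t : {s : S // (s : X.E) ∈ F}, (f (X.src t) - f (X.tgt t)) * c t = 0 := by
      have h2 : ∀ t : {s : S // (s : X.E) ∈ F}, f (X.src t) - f (X.tgt t) = ∑ x, f x * b x t := by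
        intro t
        simp [b, mul_sub, Finset.sum_sub_distrib]
      simp only [h2, Finset.sum_mul]
      rw [Finset.sum_comm]
      refine Finset.sum_eq_zero fun x _ => ?_
      rw [← mul_zero (f x), ← hall x, Finset.mul_sum]
      exact Finset.sum_congr rfl fun t _ => by ring
    rw [Finset.sum_eq_single s₀] at h1
    · exact sub_eq_zero.1 ((mul_eq_zero.1 h1).resolve_right hs₀)
    · intro t _ ht
      rw [hother t t.2 fun h => ht (Subtype.ext h), sub_self, zero_mul]
    · simp
  · exact hother s hs hss

theorem ncard_removeEdge_lt {S F : Set X.E} (hS : X.IsSection S) (hF : ∀ e ∈ F, X.inv e ∈ F)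
    {e : X.E} (he : e ∈ F) :
    {s : S | (s : X.E) ∈ X.removeEdge F e}.ncard < {s : S | (s : X.E) ∈ F}.ncard := by
  refine Set.ncard_lt_ncard ⟨fun s hs => hs.1, fun hh => ?_⟩
  by_cases heS : e ∈ S
  · have : (⟨e, heS⟩ : S) ∈ {s : S | (s : X.E) ∈ X.removeEdge F e} := hh he
    exact (mem_removeEdge.1 this).2.1 rfl
  · have : (⟨X.inv e, (hS e).2 heS⟩ : S) ∈ {s : S | (s : X.E) ∈ X.removeEdge F e} := hh (hF e he)
    exact (mem_removeEdge.1 this).2.2 rfl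

/-- Replaces acyclicity by a count: a connected set with surplus edges has a removable one, and one
with |V| - 1 edges has none. -/
theorem isSpanningTree_iff {S F : Set X.E} (hS : X.IsSection S) :
    X.IsSpanningTree F ↔ (∀ e ∈ F, X.inv e ∈ F) ∧ X.ConnectedOn F ∧
      {s : S | (s : X.E) ∈ F}.ncard + 1 = Nat.card X.V := by
  refine and_congr_right fun hF => and_congr_right fun hc => ⟨fun h => ?_, fun h => ?_⟩
  · by_contra hne
    obtain ⟨e, he, hce⟩ := hc.exists_removeEdge hS hF
      (lt_of_le_of_ne (hc.card_le hS hF) (Ne.symm hne))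
    exact h.not_connectedOn_removeEdge he hce
  · refine hc.acyclicOn hF fun e he hce => ?_
    have h1 := hce.card_le hS (inv_mem_removeEdge hF e)
    have h2 := ncard_removeEdge_lt hS hF he
    omega

end Multigraph

/-! ### The matrix-tree theorem -/

theorem Fintype.card_filter_image_univ_eq {V A : Type*} [Fintype V] [DecidableEq V] [Fintype A]
    [DecidableEq A]
    (R : Finset A) (hR : R.card = Fintype.card V) :
    (Finset.univ.filter fun f : V → A => Finset.univ.image f = R).card =
      (Fintype.card V).factorial := by
  have h0 : Fintype.card V = Fintype.card R := by rw [Fintype.card_coe, hR]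
  have h1 : Fintype.card (V ≃ R) = (Fintype.card V).factorial :=
    Fintype.card_equiv (Fintype.equivOfCardEq h0)
  rw [← h1, ← Finset.card_univ]
  symm
  refine Finset.card_bij (fun e _ v => (e v : A)) ?_ ?_ ?_
  · intro e _
    simp only [Finset.mem_filter, Finset.mem_univ, true_and]
    ext a
    simp only [Finset.mem_image, Finset.mem_univ, true_and]
    refine ⟨fun ⟨v, hv⟩ => hv ▸ (e v).2, fun ha => ⟨e.symm ⟨a, ha⟩, by simp⟩⟩
  · intro e _ e' _ h
    ext v
    exact congrFun h v
  · intro f hf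
    simp only [Finset.mem_filter, Finset.mem_univ, true_and] at hf
    have hmem : ∀ v, f v ∈ R := fun v => hf ▸ Finset.mem_image_of_mem f (Finset.mem_univ v)
    let g : V → R := fun v => ⟨f v, hmem v⟩
    have hg : Function.Bijective g := by
      rw [Fintype.bijective_iff_surjective_and_card]
      refine ⟨fun ⟨a, ha⟩ => ?_, h0⟩
      rw [← hf] at ha
      obtain ⟨v, -, hv⟩ := Finset.mem_image.1 ha
      exact ⟨v, Subtype.ext hv⟩
    exact ⟨Equiv.ofBijective g hg, Finset.mem_univ _, rfl⟩

namespace Multigraph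

variable {X : Multigraph.{u, v}} {S : Set X.E}

/-- The directed edges that belong to the undirected edges given by `T ⊆ S`. -/
def symmClosure (X : Multigraph.{u, v}) {S : Set X.E} (T : Finset S) : Set X.E :=
  {e | ∃ s ∈ T, e = s ∨ e = X.inv s}

theorem inv_mem_symmClosure (T : Finset S) :
    ∀ e ∈ X.symmClosure T, X.inv e ∈ X.symmClosure T := by
  rintro e ⟨s, hs, rfl | rfl⟩
  · exact ⟨s, hs, .inr rfl⟩
  · exact ⟨s, hs, .inl (X.inv_inv _)⟩

theorem coe_mem_symmClosure (hS : X.IsSection S) {T : Finset S} {s : S} :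
    (s : X.E) ∈ X.symmClosure T ↔ s ∈ T := by
  refine ⟨?_, fun h => ⟨s, h, .inl rfl⟩⟩
  rintro ⟨t, ht, h | h⟩
  · rwa [Subtype.ext h]
  · exact absurd t.2 ((hS t).1 (h ▸ s.2))

theorem symmClosure_injective (hS : X.IsSection S) :
    Function.Injective (X.symmClosure (S := S)) := by
  intro T T' h
  ext s
  rw [← coe_mem_symmClosure hS, h, coe_mem_symmClosure hS]

open scoped Classical in
theorem exists_symmClosure_eq (hS : X.IsSection S) {F : Set X.E}
    (hF : ∀ e ∈ F, X.inv e ∈ F) : ∃ T : Finset S, X.symmClosure T = F := by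
  refine ⟨Finset.univ.filter fun s : S => (s : X.E) ∈ F, Set.ext fun e => ⟨?_, fun he => ?_⟩⟩
  · rintro ⟨s, hs, rfl | rfl⟩
    · simpa using hs
    · exact hF _ (by simpa using hs)
  · by_cases heS : e ∈ S
    · exact ⟨⟨e, heS⟩, by simpa using he, .inl rfl⟩
    · exact ⟨⟨X.inv e, (hS e).2 heS⟩, by simpa using hF e he, .inr (X.inv_inv e).symm⟩

theorem isSpanningTree_symmClosure (hS : X.IsSection S) (T : Finset S) :
    X.IsSpanningTree (X.symmClosure T) ↔
      X.ConnectedOn (X.symmClosure T) ∧ T.card + 1 = Fintype.card X.V := by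
  have h : {s : S | (s : X.E) ∈ X.symmClosure T} = (T : Set S) := by
    ext s
    exact coe_mem_symmClosure hS
  rw [isSpanningTree_iff hS, h, Set.ncard_coe_finset, Nat.card_eq_fintype_card]
  exact and_iff_right (inv_mem_symmClosure T)

open scoped Classical in
theorem numSpanningTrees_eq_card (hS : X.IsSection S) :
    X.numSpanningTrees = (Finset.univ.filter fun T : Finset S =>
      X.ConnectedOn (X.symmClosure T) ∧ T.card + 1 = Fintype.card X.V).card := by
  rw [← Set.ncard_coe_finset, numSpanningTrees]
  symm
  refine Set.ncard_congr (fun T _ => X.symmClosure T) ?_ ?_ ?_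
  · intro T hT
    simpa [isSpanningTree_symmClosure hS] using hT
  · intro T T' _ _ h
    exact symmClosure_injective hS h
  · intro F hF
    obtain ⟨T, rfl⟩ := exists_symmClosure_eq hS hF.1
    exact ⟨T, by simpa [isSpanningTree_symmClosure hS] using hF, rfl⟩

open scoped Classical in
/-- The edges chosen by `f`. -/
noncomputable def chosen (f : X.V → Option S) : Finset S :=
  Finset.eraseNone (Finset.univ.image f)

theorem mem_chosen {f : X.V → Option S} {s : S} : s ∈ chosen f ↔ some s ∈ Set.range f := by
  simp [chosen, Finset.mem_eraseNone]

theorem det_incidence_of_none_notMem [Nonempty X.V] {f : X.V → Option S}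
    (hf : none ∉ Set.range f) : ((X.incidence S).submatrix id f).det = 0 := by
  rw [← Matrix.exists_vecMul_eq_zero_iff]
  refine ⟨1, one_ne_zero, funext fun i => ?_⟩
  rcases hi : f i with _ | s
  · exact absurd ⟨i, hi⟩ hf
  · simp [Matrix.vecMul, dotProduct, incidence, hi]

theorem det_incidence_of_not_connectedOn [Nonempty X.V] (hS : X.IsSection S)
    {f : X.V → Option S} (hf : ¬ X.ConnectedOn (X.symmClosure (chosen f))) :
    ((X.incidence S).submatrix id f).det = 0 := by
  rw [connectedOn_iff hS (inv_mem_symmClosure _)] at hf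
  push Not at hf
  obtain ⟨g, hg, a, b, hab⟩ := hf
  have h0 : (((X.incidence S).submatrix id f).map (Int.castRingHom ℚ)).det = 0 := by
    rw [← Matrix.exists_vecMul_eq_zero_iff]
    -- Subtracting the mean makes the vector orthogonal to the column of ones; it stays orthogonal
    -- to the chosen edge columns, and it is nonzero because `g` is not constant.
    refine ⟨fun x => g x - (∑ y, g y) / Fintype.card X.V, fun h => hab ?_, funext fun i => ?_⟩
    · have h1 := congrFun h a
      have h2 := congrFun h b
      simp only [Pi.zero_apply] at h1 h2
      linarith
    · rcases hi : f i with _ | s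
      · simp only [Matrix.vecMul, dotProduct, incidence, Matrix.map_apply, Matrix.submatrix_apply,
          Matrix.of_apply, hi, Option.elim, map_one, mul_one, Pi.zero_apply,
          Finset.sum_sub_distrib, Finset.sum_const, Finset.card_univ, nsmul_eq_mul]
        have : (Fintype.card X.V : ℚ) ≠ 0 := by simp
        field_simp
        simp
      · have := hg s ((coe_mem_symmClosure hS).2 (mem_chosen.2 ⟨i, hi⟩))
        simp [Matrix.vecMul, dotProduct, incidence, hi, mul_sub, Finset.sum_sub_distrib, this]
  rw [← RingHom.mapMatrix_apply, ← RingHom.map_det] at h0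
  simpa using h0

/-- The columns of the minor span the same lattice as |V|·d x₀ and the differences d x - d x₀:
connectedness yields all differences, and the vector of ones is |V|·d x₀ modulo these. Hence the
minor has determinant ±|V|. -/
theorem det_incidence_sq_of_connectedOn {f : X.V → Option S}
    (hn : none ∈ Set.range f) (hf : X.ConnectedOn (X.symmClosure (chosen f))) :
    ((X.incidence S).submatrix id f).det ^ 2 = (Fintype.card X.V : ℤ) ^ 2 := by
  obtain ⟨x₀⟩ := hf.1
  set B := (X.incidence S).submatrix id f with hB
  let d : X.V → X.V → ℤ := fun x => Pi.single x 1
  have hsum : (1 : X.V → ℤ) = ∑ x, d x := by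
    ext y
    simp [d, Finset.sum_apply, Pi.single_apply]
  let u : X.V → ℤ := fun x => if x = x₀ then 0 else 1
  -- A basis matrix of that lattice, as a product of a matrix of determinant 1 and a diagonal one,
  -- so that its determinant is visibly |V|.
  let C : Matrix X.V X.V ℤ :=
    (1 + Matrix.replicateCol Unit (-d x₀) * Matrix.replicateRow Unit u) *
      Matrix.diagonal fun x => if x = x₀ then (Fintype.card X.V : ℤ) else 1
  have hCdet : C.det = Fintype.card X.V := by
    rw [Matrix.det_mul, Matrix.det_one_add_replicateCol_mul_replicateRow, Matrix.det_diagonal,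
      Finset.prod_ite_eq' Finset.univ x₀]
    simp [u, d, dotProduct_neg]
  have hC₀ : C.col x₀ = (Fintype.card X.V : ℤ) • d x₀ := by
    ext y
    simp only [C, Matrix.col_apply]
    rw [Matrix.mul_diagonal]
    simp [u, d, Matrix.mul_apply, Matrix.one_apply, Pi.single_apply]
  have hC : ∀ x ≠ x₀, C.col x = d x - d x₀ := by
    intro x hx
    ext y
    simp only [C, Matrix.col_apply]
    rw [Matrix.mul_diagonal]
    simp [u, d, hx, Matrix.mul_apply, Matrix.one_apply, Pi.single_apply, sub_eq_add_neg]
  have hnone : ∀ i, f i = none → B.col i = 1 := by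
    intro i hi
    ext y
    simp [hB, incidence, hi]
  have hsome : ∀ i s, f i = some s → B.col i = d (X.src s) - d (X.tgt s) := by
    intro i s hi
    ext y
    simp [hB, incidence, hi, d, Pi.single_apply]
  have hcard : (Fintype.card X.V : ℤ) • d x₀ = 1 - ∑ x, (d x - d x₀) := by
    rw [Finset.sum_sub_distrib, ← hsum]
    simp
  have h1 : B.det ∣ C.det := by
    refine Matrix.det_dvd_det_of_col_mem_span _ _ fun j => ?_
    set W := Submodule.span ℤ (Set.range B.col)
    have hd : ∀ x y, d x - d y ∈ W := by
      intro x y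
      rw [← Submodule.Quotient.eq]
      refine Joined.apply_eq (F := X.symmClosure (chosen f))
        (f := fun x => (Submodule.Quotient.mk (d x) : (X.V → ℤ) ⧸ W)) ?_ (hf.2 x y)
      have hs : ∀ s ∈ chosen f, (Submodule.Quotient.mk (d (X.src s)) : (X.V → ℤ) ⧸ W) =
          Submodule.Quotient.mk (d (X.tgt s)) := by
        intro s hs
        obtain ⟨i, hi⟩ := mem_chosen.1 hs
        rw [Submodule.Quotient.eq, ← hsome i s hi]
        exact Submodule.subset_span ⟨i, rfl⟩
      rintro e ⟨s, hs', rfl | rfl⟩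
      · exact hs s hs'
      · rw [X.src_inv, X.tgt_inv]
        exact (hs s hs').symm
    by_cases hj : j = x₀
    · rw [hj, hC₀, hcard]
      refine W.sub_mem ?_ (W.sum_mem fun x _ => hd _ _)
      obtain ⟨i, hi⟩ := hn
      rw [← hnone i hi]
      exact Submodule.subset_span ⟨i, rfl⟩
    · rw [hC j hj]
      exact hd _ _
  have h2 : C.det ∣ B.det := by
    refine Matrix.det_dvd_det_of_col_mem_span _ _ fun j => ?_
    set W := Submodule.span ℤ (Set.range C.col)
    have hd : ∀ x, d x - d x₀ ∈ W := by
      intro x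
      by_cases hx : x = x₀
      · simp [hx]
      · rw [← hC x hx]
        exact Submodule.subset_span ⟨x, rfl⟩
    rcases hj : f j with _ | s
    · rw [hnone j hj, ← sub_add_cancel 1 (∑ x, (d x - d x₀)), ← hcard, ← hC₀]
      exact W.add_mem (Submodule.subset_span ⟨x₀, rfl⟩) (W.sum_mem fun x _ => hd x)
    · rw [hsome j s hj, ← sub_sub_sub_cancel_right _ _ (d x₀)]
      exact W.sub_mem (hd _) (hd _)
  rw [← hCdet]
  exact Int.natAbs_eq_iff_sq_eq.1 (Nat.dvd_antisymm (Int.natAbs_dvd_natAbs.2 h1)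
    (Int.natAbs_dvd_natAbs.2 h2))

-- Counts the nonzero minors. Such an `f` is injective, so it enumerates the column of ones together
-- with the edges of a spanning tree; each tree arises from |V|! enumerations.
open scoped Classical in
theorem card_filter_chosen [Nonempty X.V] (hS : X.IsSection S) :
    (Finset.univ.filter fun f : X.V → Option S => none ∈ Set.range f ∧
      X.ConnectedOn (X.symmClosure (chosen f))).card =
      (Fintype.card X.V).factorial * X.numSpanningTrees := by
  have himage : ∀ f : X.V → Option S, none ∈ Set.range f →
      Finset.univ.image f = Finset.insertNone (chosen f) := by
    rintro f hf
    ext o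
    rcases o with _ | s
    · simpa using hf
    · simp [mem_chosen]
  rw [numSpanningTrees_eq_card hS, mul_comm, ← smul_eq_mul, ← Finset.sum_const]
  rw [Finset.card_eq_sum_card_fiberwise (f := chosen) (t := Finset.univ.filter fun T : Finset S =>
      X.ConnectedOn (X.symmClosure T) ∧ T.card + 1 = Fintype.card X.V)]
  · refine Finset.sum_congr rfl fun T hT => ?_
    simp only [Finset.mem_filter, Finset.mem_univ, true_and] at hT
    rw [← Fintype.card_filter_image_univ_eq (Finset.insertNone T)
      (by rw [Finset.card_insertNone, hT.2])]
    congr 1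
    ext f
    simp only [Finset.mem_filter, Finset.mem_univ, true_and]
    constructor
    · rintro ⟨⟨h1, h2⟩, rfl⟩
      exact himage f h1
    · intro h
      have hn : none ∈ Set.range f := by
        have : none ∈ Finset.univ.image f := by rw [h]; simp
        simpa using this
      have hT' : chosen f = T := Finset.insertNone.injective ((himage f hn).symm.trans h)
      exact ⟨⟨hn, by rw [hT']; exact hT.1⟩, hT'⟩
  · intro f hf
    simp only [Finset.coe_filter, Finset.mem_univ, true_and, Set.mem_ofPred_eq] at hf ⊢
    refine ⟨hf.2, ?_⟩
    rw [← Finset.card_insertNone, ← himage f hf.1, ← Finset.card_univ]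
    refine Finset.card_image_of_injective _ fun i j hij => ?_
    -- Two equal columns would make the minor vanish, but its square is |V|² ≠ 0.
    by_contra hne
    have h1 := det_incidence_sq_of_connectedOn hf.1 hf.2
    rw [Matrix.det_zero_of_column_eq hne fun k => by simp [hij]] at h1
    exact absurd h1.symm (by simp)

/-- The matrix-tree theorem. -/
theorem det_laplacian_add_one [Nonempty X.V] (hS : X.IsSection S) :
    (X.laplacian + Matrix.of fun _ _ => 1).det =
      (Fintype.card X.V : ℤ) ^ 2 * X.numSpanningTrees := by
  classical
  have h := Matrix.sum_det_submatrix_sq (X.incidence S)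
  rw [incidence_mul_transpose hS] at h
  have h' : ∀ f : X.V → Option S, ((X.incidence S).submatrix id f).det ^ 2 =
      if none ∈ Set.range f ∧ X.ConnectedOn (X.symmClosure (chosen f)) then
        (Fintype.card X.V : ℤ) ^ 2 else 0 := by
    intro f
    split_ifs with hf
    · exact det_incidence_sq_of_connectedOn hf.1 hf.2
    · rcases not_and_or.1 hf with hf | hf
      · rw [det_incidence_of_none_notMem hf]; rfl
      · rw [det_incidence_of_not_connectedOn hS hf]; rfl
  rw [Finset.sum_congr rfl fun f _ => h' f, ← Finset.sum_filter, Finset.sum_const,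
    card_filter_chosen hS] at h
  refine mul_left_cancel₀ (Nat.cast_ne_zero.2 (Nat.factorial_ne_zero (Fintype.card X.V))) ?_
  rw [← h]
  simp
  ring

end Multigraph

/-! ### Fourier transform over ℤ/Nℤ -/

theorem ZMod.pow_val_add {M : Type*} [Monoid M] {N : ℕ} [NeZero N] {ξ : M} (hξ : ξ ^ N = 1)
    (a b : ZMod N) : ξ ^ (a + b).val = ξ ^ a.val * ξ ^ b.val := by
  rw [ZMod.val_add, ← pow_add, ← pow_eq_pow_mod _ hξ]

theorem ZMod.sum_pow_val_eq_zero {K : Type*} [Field K] {N : ℕ} [NeZero N] {ξ : K}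
    (hξ : ξ ^ N = 1) (h1 : ξ ≠ 1) : ∑ a : ZMod N, ξ ^ a.val = 0 := by
  have h2 : ξ ^ (1 : ZMod N).val = ξ := by
    rw [ZMod.val_one_eq_one_mod, ← pow_eq_pow_mod _ hξ, pow_one]
  have h3 : ∑ a : ZMod N, ξ ^ a.val = ξ * ∑ a : ZMod N, ξ ^ a.val := by
    rw [Finset.mul_sum, ← Equiv.sum_comp (Equiv.addLeft (1 : ZMod N))]
    refine Finset.sum_congr rfl fun a _ => ?_
    rw [Equiv.coe_addLeft, ZMod.pow_val_add hξ, h2]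
  have h4 : (ξ - 1) * ∑ a : ZMod N, ξ ^ a.val = 0 := by linear_combination -h3
  exact (mul_eq_zero.1 h4).resolve_left (sub_ne_zero.2 h1)

theorem IsPrimitiveRoot.prod_pow_val {K M : Type*} [Field K] [CommMonoid M] {N : ℕ} [NeZero N]
    {ζ : K} (hζ : IsPrimitiveRoot ζ N) (g : K → M) :
    ∏ j : ZMod N, g (ζ ^ j.val) = ∏ ξ ∈ Polynomial.nthRootsFinset N (1 : K), g ξ := by
  refine Finset.prod_bij (fun j _ => ζ ^ j.val) ?_ ?_ ?_ fun _ _ => rfl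
  · intro j _
    rw [Polynomial.mem_nthRootsFinset (NeZero.pos N), ← pow_mul, mul_comm, pow_mul, hζ.pow_eq_one,
      one_pow]
  · intro i _ j _ h
    exact ZMod.val_injective N (hζ.pow_inj (ZMod.val_lt i) (ZMod.val_lt j) h)
  · intro ξ hξ
    rw [Polynomial.mem_nthRootsFinset (NeZero.pos N)] at hξ
    obtain ⟨i, hi, rfl⟩ := hζ.eq_pow_of_pow_eq_one hξ
    exact ⟨i, Finset.mem_univ _, by rw [ZMod.val_cast_of_lt hi]⟩

theorem IsPrimitiveRoot.det_fourier_ne_zero {K : Type*} [Field K] {N : ℕ} [NeZero N]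
    {ζ : K} (hζ : IsPrimitiveRoot ζ N) :
    (Matrix.of fun i j : ZMod N => (ζ ^ i.val) ^ j.val).det ≠ 0 := by
  obtain ⟨n, rfl⟩ := Nat.exists_eq_succ_of_ne_zero (NeZero.ne N)
  have h := (Matrix.det_vandermonde_ne_zero_iff (v := fun i : Fin (n + 1) => ζ ^ (i : ℕ))).2
    fun i j h => Fin.ext (hζ.pow_inj i.2 j.2 h)
  rw [← Matrix.det_submatrix_equiv_self (ZMod.finEquiv (n + 1)).toEquiv]
  exact h

/-- The determinant of a matrix of convolution operators over `ℤ/Nℤ`. -/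
theorem Matrix.det_convolution {V K : Type*} [Fintype V] [DecidableEq V] [Field K] {N : ℕ}
    [NeZero N] {ζ : K} (hζ : IsPrimitiveRoot ζ N) (c : V → V → ZMod N → K) :
    (Matrix.of fun i j : V × ZMod N => c i.1 j.1 (j.2 - i.2)).det =
      ∏ ξ ∈ Polynomial.nthRootsFinset N (1 : K),
        (Matrix.of fun x y => ∑ a, c x y a * ξ ^ a.val).det := by
  set B := Matrix.of fun i j : V × ZMod N => c i.1 j.1 (j.2 - i.2)
  let F := Matrix.kronecker (1 : Matrix V V K) (Matrix.of fun i j : ZMod N => (ζ ^ i.val) ^ j.val)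
  let D := Matrix.blockDiagonal fun j : ZMod N =>
    Matrix.of fun x y => ∑ a, c x y a * (ζ ^ j.val) ^ a.val
  have hF : F.det ≠ 0 := by
    have h := Matrix.det_kronecker (1 : Matrix V V K)
      (Matrix.of fun i j : ZMod N => (ζ ^ i.val) ^ j.val)
    rw [Matrix.det_one, one_pow, one_mul] at h
    exact h.trans_ne (pow_ne_zero _ hζ.det_fourier_ne_zero)
  -- The Fourier matrix diagonalises convolution: translating the summation variable by σ pulls the
  -- character value at σ out of the sum.
  have hBF : B * F = F * D := by
    ext ⟨x, σ⟩ ⟨y, j⟩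
    have hl : (B * F) (x, σ) (y, j) = ∑ τ, c x y (τ - σ) * (ζ ^ τ.val) ^ j.val := by
      rw [Matrix.mul_apply, Fintype.sum_prod_type, Finset.sum_eq_single y]
      · simp [B, F, Matrix.kronecker]
      · intro b _ hb
        simp [F, Matrix.kronecker, Matrix.one_apply_ne hb]
      · simp
    have hr : (F * D) (x, σ) (y, j) =
        (ζ ^ σ.val) ^ j.val * ∑ a, c x y a * (ζ ^ j.val) ^ a.val := by
      rw [Matrix.mul_apply, Fintype.sum_prod_type, Finset.sum_eq_single x,
        Finset.sum_eq_single j]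
      · simp [D, F, Matrix.kronecker]
      · intro b _ hb
        simp [D, Matrix.blockDiagonal_apply_ne _ _ _ hb]
      · simp
      · intro b _ hb
        simp [F, Matrix.kronecker, Matrix.one_apply_ne (Ne.symm hb)]
      · simp
    rw [hl, hr, ← Equiv.sum_comp (Equiv.addRight σ), Finset.mul_sum]
    refine Finset.sum_congr rfl fun a _ => ?_
    rw [Equiv.coe_addRight, add_sub_cancel_right, ZMod.pow_val_add hζ.pow_eq_one]
    ring
  have h := congrArg Matrix.det hBF
  rw [Matrix.det_mul, Matrix.det_mul, mul_comm] at h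
  rw [mul_left_cancel₀ hF h, Matrix.det_blockDiagonal]
  exact hζ.prod_pow_val fun ξ => (Matrix.of fun x y => ∑ a, c x y a * ξ ^ a.val).det

/-- Since LJ = 0 and J² = |V| J, one has L + cJ = (L + J)(1 + tJ) with t = (c - 1)/|V|, and det(1 +
tJ) = c. -/
theorem Matrix.det_add_const {V K : Type*} [Fintype V] [DecidableEq V] [Nonempty V] [Field K]
    [CharZero K] (L : Matrix V V K) (hL : ∀ x, ∑ y, L x y = 0) (c : K) :
    (L + Matrix.of fun _ _ => c).det = c * (L + Matrix.of fun _ _ => 1).det := by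
  set t : K := (c - 1) / Fintype.card V
  have hn : (Fintype.card V : K) ≠ 0 := by simp
  have ht : t * Fintype.card V = c - 1 := div_mul_cancel₀ _ hn
  have h : L + Matrix.of (fun _ _ => c) = (L + Matrix.of fun _ _ => 1) *
      (1 + Matrix.replicateCol Unit (fun _ : V => t) * Matrix.replicateRow Unit (1 : V → K)) := by
    ext x y
    rw [mul_add, mul_one]
    simp only [Matrix.add_apply, Matrix.mul_apply, Matrix.of_apply, Matrix.replicateCol_apply,
      Matrix.replicateRow_apply, Finset.univ_unique, Finset.sum_singleton, Pi.one_apply, mul_one,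
      ← Finset.sum_mul, Finset.sum_add_distrib, hL]
    simp only [Finset.sum_const, Finset.card_univ, nsmul_eq_mul, mul_one]
    linear_combination -ht
  rw [h, Matrix.det_mul, Matrix.det_one_add_replicateCol_mul_replicateRow, mul_comm]
  congr 1
  simp [dotProduct]
  linear_combination ht

/-! ### The product formula for derived multigraphs -/

namespace Multigraph

variable {X : Multigraph.{u, v}} {S : Set X.E}

/-- The Laplacian twisted by a character of `ℤ/Nℤ`. -/
noncomputable def twistedLaplacian {K : Type*} [CommRing K] {N : ℕ} (hS : X.IsSection S)
    (α : S → ZMod N) (ξ : K) : Matrix X.V X.V K :=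
  Matrix.of fun x y => ∑ e, (if x = X.src e then (1 : K) else 0) *
    ((if y = X.src e then 1 else 0) - (if y = X.tgt e then ξ ^ (X.extend hS α e).val else 0))

theorem isSection_derived (hS : X.IsSection S) {G : Type} [AddCommGroup G] [Finite G]
    (α : S → G) : (X.derived hS α).IsSection (Prod.fst ⁻¹' S : Set (X.E × G)) :=
  fun e => hS e.1

/-- The vertices of a derived multigraph are pairs. -/
def derivedVEquiv (hS : X.IsSection S) {G : Type} [AddCommGroup G] [Finite G] (α : S → G) :
    X.V × G ≃ (X.derived hS α).V := Equiv.refl _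

/-- The directed edges of a derived multigraph are pairs. -/
def derivedEEquiv (hS : X.IsSection S) {G : Type} [AddCommGroup G] [Finite G] (α : S → G) :
    (X.derived hS α).E ≃ X.E × G := Equiv.refl _

theorem laplacian_derived_apply (hS : X.IsSection S) {N : ℕ} [NeZero N] (α : S → ZMod N)
    (i j : X.V × ZMod N) :
    (X.derived hS α).laplacian (derivedVEquiv hS α i) (derivedVEquiv hS α j) =
      ∑ e, (if i.1 = X.src e then (1 : ℤ) else 0) *
        ((if j.1 = X.src e then (if j.2 - i.2 = 0 then 1 else 0) else 0) -
          (if j.1 = X.tgt e then (if j.2 - i.2 = X.extend hS α e then 1 else 0) else 0)) := by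
  classical
  obtain ⟨x, σ⟩ := i
  obtain ⟨y, τ⟩ := j
  have h : (X.derived hS α).laplacian (derivedVEquiv hS α (x, σ)) (derivedVEquiv hS α (y, τ)) =
      ∑ e : X.E × ZMod N,
      (if (x, σ) = (X.src e.1, e.2) then (1 : ℤ) else 0) *
      ((if (y, τ) = (X.src e.1, e.2) then 1 else 0) -
        (if (y, τ) = (X.tgt e.1, e.2 + X.extend hS α e.1) then 1 else 0)) := by
    rw [laplacian_apply]
    refine Fintype.sum_equiv (derivedEEquiv hS α) _ _ fun e => ?_
    congr!
  rw [h, Fintype.sum_prod_type]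
  refine Finset.sum_congr rfl fun e _ => ?_
  rw [Finset.sum_eq_single σ]
  · simp only [Prod.mk.injEq, and_true, ite_and, sub_eq_iff_eq_add, zero_add, add_comm σ]
  · intro ρ _ hρ
    simp [Ne.symm hρ]
  · simp

-- Under the Fourier transform the all-ones matrix contributes ∑ ξᵃ, which is 0 for ξ ≠ 1 and N for
-- ξ = 1. The factor N extracted at ξ = 1 cancels one of the two in (|V| N)².
open scoped Classical in
theorem prod_det_twistedLaplacian {K : Type*} [Field K] [CharZero K] [Nonempty X.V]
    (hS : X.IsSection S) {N : ℕ} [NeZero N] (α : S → ZMod N) {ζ : K}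
    (hζ : IsPrimitiveRoot ζ N) :
    (Fintype.card X.V : K) ^ 2 * N * (X.derived hS α).numSpanningTrees =
      (twistedLaplacian hS α (1 : K) + Matrix.of fun _ _ => 1).det *
        ∏ ξ ∈ (Polynomial.nthRootsFinset N (1 : K)).erase 1, (twistedLaplacian hS α ξ).det := by
  have hne : Nonempty (X.derived hS α).V := inferInstanceAs (Nonempty (X.V × ZMod N))
  -- The convolution kernel of the derived Laplacian; the final `+ 1` is the all-ones matrix.
  let c : X.V → X.V → ZMod N → K := fun x y a =>
    ∑ e, (if x = X.src e then (1 : K) else 0) *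
        ((if y = X.src e then (if a = 0 then 1 else 0) else 0) -
          (if y = X.tgt e then (if a = X.extend hS α e then 1 else 0) else 0)) + 1
  have hc : ∀ ξ : K, (Matrix.of fun x y => ∑ a, c x y a * ξ ^ a.val) =
      twistedLaplacian hS α ξ + Matrix.of fun _ _ => ∑ a : ZMod N, ξ ^ a.val := by
    intro ξ
    ext x y
    simp only [c, Matrix.of_apply, Matrix.add_apply, twistedLaplacian, add_mul, one_mul,
      Finset.sum_add_distrib, Finset.sum_mul]
    rw [Finset.sum_comm]
    congr 1
    refine Finset.sum_congr rfl fun e _ => ?_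
    simp only [mul_assoc, ← Finset.mul_sum]
    congr 1
    simp only [sub_mul, Finset.sum_sub_distrib]
    split_ifs <;> simp
  have h1 := Matrix.det_convolution hζ c
  have h2 : (Matrix.of fun i j : X.V × ZMod N => c i.1 j.1 (j.2 - i.2)).det =
      (((X.derived hS α).laplacian + Matrix.of fun _ _ => 1).det : ℤ) := by
    have h3 : (Matrix.of fun i j : X.V × ZMod N => c i.1 j.1 (j.2 - i.2)) =
        (((X.derived hS α).laplacian + Matrix.of fun _ _ => 1).map (Int.castRingHom K)).submatrix
          (derivedVEquiv hS α) (derivedVEquiv hS α) := by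
      ext i j
      simp only [Matrix.map_apply, Matrix.submatrix_apply, Matrix.add_apply, Matrix.of_apply, c,
        laplacian_derived_apply hS α i j]
      rw [eq_intCast]
      push_cast
      rfl
    rw [h3, Matrix.det_submatrix_equiv_self, ← RingHom.mapMatrix_apply, ← RingHom.map_det]
    rfl
  rw [h2, det_laplacian_add_one (isSection_derived hS α)] at h1
  have hcard : Fintype.card (X.derived hS α).V = Fintype.card X.V * N := by
    rw [← Nat.card_eq_fintype_card, ← Nat.card_eq_fintype_card]
    change Nat.card (X.V × ZMod N) = _
    rw [Nat.card_prod, Nat.card_zmod]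
  have hmem : (1 : K) ∈ Polynomial.nthRootsFinset N (1 : K) := by
    rw [Polynomial.mem_nthRootsFinset (NeZero.pos N), one_pow]
  have hrow : ∀ x, ∑ y, twistedLaplacian hS α (1 : K) x y = 0 := by
    intro x
    simp only [twistedLaplacian, Matrix.of_apply, one_pow]
    rw [Finset.sum_comm]
    refine Finset.sum_eq_zero fun e _ => ?_
    simp
  simp only [hc] at h1
  rw [← Finset.mul_prod_erase _ _ hmem, Matrix.det_add_const _ hrow, hcard] at h1
  have hN : (N : K) ≠ 0 := by simp [NeZero.ne N]
  have h4 : ∏ ξ ∈ (Polynomial.nthRootsFinset N (1 : K)).erase 1,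
      (twistedLaplacian hS α ξ + Matrix.of fun _ _ => ∑ a : ZMod N, ξ ^ a.val).det =
      ∏ ξ ∈ (Polynomial.nthRootsFinset N (1 : K)).erase 1, (twistedLaplacian hS α ξ).det := by
    refine Finset.prod_congr rfl fun ξ hξ => ?_
    rw [Finset.mem_erase, Polynomial.mem_nthRootsFinset (NeZero.pos N)] at hξ
    rw [ZMod.sum_pow_val_eq_zero hξ.2 hξ.1]
    congr 1
    ext
    simp
  rw [h4] at h1
  refine mul_left_cancel₀ hN ?_
  push_cast at h1
  simp only [one_pow, Finset.sum_const, Finset.card_univ, ZMod.card, nsmul_eq_mul, mul_one] at h1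
  linear_combination h1

end Multigraph

/-! ### Zeros of generalized polynomials in characteristic p -/

theorem Finset.eq_zero_of_forall_sum_mul_pow_eq_zero {ι k : Type*} [Field k] (s : Finset ι)
    (x v : ι → k) (hx : Set.InjOn x s) (h : ∀ t : ℕ, ∑ a ∈ s, v a * x a ^ t = 0) :
    ∀ a ∈ s, v a = 0 := by
  let e := s.equivFin.symm
  have h0 : (fun i => v (e i)) = 0 := by
    refine Matrix.eq_zero_of_forall_pow_sum_mul_pow_eq_zero (f := fun i => x (e i)) ?_ ?_
    · intro i j hij
      exact e.injective (Subtype.ext (hx (e i).2 (e j).2 hij))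
    · intro t
      rw [← h t, ← Finset.sum_coe_sort s]
      exact e.sum_comp fun a : s => v a * x a ^ (t : ℕ)
  intro a ha
  simpa [e] using congrFun h0 (s.equivFin ⟨a, ha⟩)

/-- From some level `c` on, every valuation is attained by some p^r - 1, as raising to the ℓ-th
power increases it by exactly one. Starting modulo ℓ² forces c ≥ 2, which keeps the quadratic
remainder harmless for every ℓ, including 2. -/
theorem Nat.exists_pow_eq_one_add_prime_pow_mul {ℓ p : ℕ} (hℓ : ℓ.Prime) (hp : 1 < p)
    (h : p.Coprime ℓ) : ∃ c, ∀ j, ∃ r u, p ^ r = 1 + ℓ ^ (c + j) * u ∧ u.Coprime ℓ := by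
  have hφ : 0 < (ℓ ^ 2).totient := Nat.totient_pos.2 (pow_pos hℓ.pos 2)
  have h1 : 1 < p ^ (ℓ ^ 2).totient := Nat.one_lt_pow hφ.ne' hp
  have h2 : ℓ ^ 2 ∣ p ^ (ℓ ^ 2).totient - 1 :=
    (Nat.modEq_iff_dvd' h1.le).1 (Nat.ModEq.pow_totient (h.pow_right 2)).symm
  obtain ⟨c, u, hu, hcu⟩ := Nat.exists_eq_pow_mul_and_not_dvd
    (n := p ^ (ℓ ^ 2).totient - 1) (by omega) ℓ hℓ.ne_one
  have hcop : ∀ {w}, ¬ ℓ ∣ w → w.Coprime ℓ := fun hw => ((hℓ.coprime_iff_not_dvd).2 hw).symm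
  have hc : 2 ≤ c := by
    by_contra! hlt
    refine hu ?_
    rw [hcu] at h2
    have h3 : ℓ ^ c * ℓ ∣ ℓ ^ c * u := by
      rw [← pow_succ]
      exact (pow_dvd_pow ℓ hlt).trans h2
    exact Nat.dvd_of_mul_dvd_mul_left (pow_pos hℓ.pos c) h3
  refine ⟨c, fun j => ?_⟩
  induction j with
  | zero => exact ⟨(ℓ ^ 2).totient, u, by rw [add_zero, ← hcu]; omega, hcop hu⟩
  | succ j ih =>
    obtain ⟨r, w, hr, hw⟩ := ih
    obtain ⟨k, hk⟩ := Polynomial.powAddExpansion 1 (ℓ ^ (c + j) * w) ℓ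
    obtain ⟨b, rfl⟩ : ∃ b, c = b + 2 := ⟨c - 2, by omega⟩
    refine ⟨r * ℓ, w + ℓ * (ℓ ^ (b + j) * w ^ 2 * k), ?_, ?_⟩
    · rw [pow_mul, hr, hk, Nat.cast_id]
      ring
    · exact (Nat.coprime_add_mul_left_left _ _ _).2 hw

/-- (1 + y)ᵗ ≡ 1 + ty modulo y². This makes the Frobenius orbit of ξ look like a geometric
progression. -/
theorem pow_one_add_pow_eq {M : Type*} [CommMonoid M] {ξ : M} {y : ℕ} (h : ξ ^ (y * y) = 1)
    (t : ℕ) : ξ ^ (1 + y) ^ t = ξ * (ξ ^ y) ^ t := by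
  induction t with
  | zero => simp
  | succ t ih =>
    have h1 : ((ξ ^ y) ^ t) ^ y = 1 := by
      rw [← pow_mul, mul_comm, pow_mul, ← pow_mul ξ, h, one_pow]
    rw [pow_succ, pow_mul, ih, pow_add, pow_one, mul_pow ξ, h1, mul_one, pow_succ, mul_assoc]

/-- The product of the 1 - ξʲ for 0 < j < N is N, so no factor can vanish in `k`. -/
theorem IsPrimitiveRoot.map_of_natCast_ne_zero {R k : Type*} [CommRing R] [IsDomain R] [Field k]
    {ξ : R} {N : ℕ} (hN : 0 < N) (hξ : IsPrimitiveRoot ξ N) (φ : R →+* k) (hk : (N : k) ≠ 0) :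
    IsPrimitiveRoot (φ ξ) N := by
  obtain ⟨n, rfl⟩ := Nat.exists_eq_succ_of_ne_zero hN.ne'
  have h := congrArg φ hξ.prod_one_sub_pow_eq_order
  rw [map_prod] at h
  refine IsPrimitiveRoot.mk_of_lt _ hN (by rw [← map_pow, hξ.pow_eq_one, map_one]) ?_
  intro j hj hlt h1
  obtain ⟨i, rfl⟩ := Nat.exists_eq_succ_of_ne_zero hj.ne'
  refine hk ?_
  rw [Finset.prod_eq_zero (i := i) (by simpa using hlt)] at h
  · simpa using h.symm
  · rw [map_sub, map_pow, h1, map_one, sub_self]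

namespace GenPoly

section Eval

variable {ℓ : ℕ} [Fact ℓ.Prime] {R : Type*} [CommRing R]

instance neZero_prime_pow (n : ℕ) : NeZero (ℓ ^ n) :=
  ⟨pow_ne_zero _ (Fact.out : ℓ.Prime).ne_zero⟩

/-- Evaluation at `ξ` as a ring homomorphism. -/
noncomputable def evalHom (n : ℕ) (ξ : R) (hξ : ξ ^ ℓ ^ n = 1) :
    AddMonoidAlgebra ℤ ℤ_[ℓ] →+* R :=
  (AddMonoidAlgebra.lift ℤ R ℤ_[ℓ]
    { toFun := fun a => ξ ^ (PadicInt.toZModPow n a.toAdd).val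
      map_one' := by simp
      map_mul' := fun a b => by rw [toAdd_mul, map_add, ZMod.pow_val_add hξ] }).toRingHom

theorem evalHom_apply (n : ℕ) (ξ : R) (hξ : ξ ^ ℓ ^ n = 1) (P : AddMonoidAlgebra ℤ ℤ_[ℓ]) :
    evalHom n ξ hξ P = eval n ξ P := by
  simp [evalHom, eval, AddMonoidAlgebra.lift_apply]

theorem evalHom_single (n : ℕ) (ξ : R) (hξ : ξ ^ ℓ ^ n = 1) (a : ℤ_[ℓ]) :
    evalHom n ξ hξ (AddMonoidAlgebra.single a 1) = ξ ^ (PadicInt.toZModPow n a).val := by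
  simp [evalHom]

theorem map_eval {R' : Type*} [CommRing R'] (φ : R →+* R') (n : ℕ) (ξ : R)
    (P : AddMonoidAlgebra ℤ ℤ_[ℓ]) : φ (eval n ξ P) = eval n (φ ξ) P := by
  simp [eval, Finsupp.sum]

theorem pow_toZModPow_val {m n : ℕ} (hmn : m ≤ n) {ξ : R} (hξ : ξ ^ ℓ ^ m = 1) (a : ℤ_[ℓ]) :
    ξ ^ (PadicInt.toZModPow n a).val = ξ ^ (PadicInt.toZModPow m a).val := by
  rw [← PadicInt.cast_toZModPow m n hmn, ZMod.cast_eq_val, ZMod.val_natCast,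
    ← pow_eq_pow_mod _ hξ]

theorem eval_eq_of_le {m n : ℕ} (hmn : m ≤ n) {ξ : R} (hξ : ξ ^ ℓ ^ m = 1)
    (P : AddMonoidAlgebra ℤ ℤ_[ℓ]) : eval n ξ P = eval m ξ P := by
  simp only [eval, pow_toZModPow_val hmn hξ]

end Eval

/-- Two distinct ℓ-adic integers differ at all sufficiently high levels, and there are finitely many
pairs. -/
theorem exists_injOn_toZModPow {ℓ : ℕ} [Fact ℓ.Prime] (s : Finset ℤ_[ℓ]) :
    ∃ m : ℕ, Set.InjOn (PadicInt.toZModPow m : ℤ_[ℓ] → ZMod (ℓ ^ m)) s := by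
  have h : ∀ᶠ m in Filter.atTop, ∀ a ∈ s, ∀ b ∈ s,
      PadicInt.toZModPow m a = PadicInt.toZModPow m b → a = b := by
    rw [Filter.eventually_all_finset]
    intro a _
    rw [Filter.eventually_all_finset]
    intro b _
    by_cases hab : a = b
    · simp [hab]
    obtain ⟨n, hn⟩ := not_forall.1 (mt PadicInt.ext_of_toZModPow.1 hab)
    filter_upwards [Filter.eventually_ge_atTop n] with m hm hmab
    refine absurd ?_ hn
    rw [← PadicInt.cast_toZModPow n m hm, hmab, PadicInt.cast_toZModPow n m hm]
  obtain ⟨m, hm⟩ := h.exists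
  exact ⟨m, fun a ha b hb => hm a ha b hb⟩

/-- A generalized polynomial that is nonzero modulo `p` has only finitely many zeros of `ℓ`-power
order in a field of characteristic `p`. -/
theorem exists_forall_eval_ne_zero {ℓ p : ℕ} [Fact ℓ.Prime] [Fact p.Prime] (hℓp : ℓ ≠ p)
    {g : AddMonoidAlgebra ℤ ℤ_[ℓ]} {a₀ : ℤ_[ℓ]} (ha₀ : ¬ (p : ℤ) ∣ g.coeff a₀)
    (k : Type*) [Field k] [CharP k p] :
    ∃ N, ∀ i, N ≤ i → ∀ ξ : k, IsPrimitiveRoot ξ (ℓ ^ i) → eval i ξ g ≠ 0 := by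
  have hℓ : ℓ.Prime := Fact.out
  have hp : p.Prime := Fact.out
  obtain ⟨m, hm⟩ := exists_injOn_toZModPow g.coeff.support
  obtain ⟨c, hc⟩ := Nat.exists_pow_eq_one_add_prime_pow_mul hℓ hp.one_lt
    ((Nat.coprime_primes hp hℓ).2 hℓp.symm)
  refine ⟨2 * m + c, fun i hi ξ hξ h0 => ?_⟩
  -- Choose p^r = 1 + y so that y has ℓ-adic valuation i - m. Then ξ^y has order ℓᵐ, and i ≥ 2m + c
  -- ensures that ℓⁱ divides y².
  obtain ⟨j, rfl⟩ : ∃ j, i = m + (c + (m + j)) := ⟨i - (2 * m + c), by omega⟩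
  obtain ⟨r, u, hr, hu⟩ := hc (m + j)
  set y := ℓ ^ (c + (m + j)) * u with hy
  have hyy : ξ ^ (y * y) = 1 := by
    refine (hξ.pow_eq_one_iff_dvd _).2 ?_
    rw [hy, show ℓ ^ (c + (m + j)) * u * (ℓ ^ (c + (m + j)) * u) =
      ℓ ^ (m + (c + (m + j))) * (ℓ ^ (c + j) * u * u) by ring]
    exact dvd_mul_right _ _
  have hζ : IsPrimitiveRoot (ξ ^ y) (ℓ ^ m) := by
    rw [hy, pow_mul]
    refine (hξ.pow (pow_pos hℓ.pos _) ?_).pow_of_coprime u (hu.pow_right m)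
    rw [pow_add, mul_comm]
  -- The point is ξ raised to p^(rt), and an iterated Frobenius fixes the integer coefficients of
  -- `g`.
  have hzero : ∀ t : ℕ, eval (m + (c + (m + j))) (ξ * (ξ ^ y) ^ t) g = 0 := by
    intro t
    rw [← pow_one_add_pow_eq hyy, ← hr, ← pow_mul, ← iterateFrobenius_def (p := p), ← map_eval, h0,
      map_zero]
  -- The nodes are the values ζᵃ with ζ = ξ^y. They are distinct because the exponents of `g` are
  -- distinct modulo ℓᵐ.
  have hv := Finset.eq_zero_of_forall_sum_mul_pow_eq_zero g.coeff.support
    (fun a => (ξ ^ y) ^ (PadicInt.toZModPow (m + (c + (m + j))) a).val)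
    (fun a => (g.coeff a : k) * ξ ^ (PadicInt.toZModPow (m + (c + (m + j))) a).val) ?_ ?_ a₀ ?_
  · rcases mul_eq_zero.1 hv with h | h
    · exact ha₀ ((CharP.intCast_eq_zero_iff k p _).1 h)
    · exact pow_ne_zero _ (hξ.ne_zero (pow_ne_zero _ hℓ.ne_zero)) h
  · intro a ha b hb hab
    simp only [pow_toZModPow_val (Nat.le_add_right m _) hζ.pow_eq_one] at hab
    exact hm ha hb (ZMod.val_injective _ (hζ.pow_inj (ZMod.val_lt _) (ZMod.val_lt _) hab))
  · intro t
    rw [← hzero t, eval, Finsupp.sum]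
    refine Finset.sum_congr rfl fun a _ => ?_
    rw [mul_pow, ← pow_mul (ξ ^ y), ← pow_mul (ξ ^ y), mul_assoc, mul_comm t]
  · rw [Finsupp.mem_support_iff]
    rintro h
    exact ha₀ (h ▸ dvd_zero _)

/-! ### Reduction modulo 𝔪_∞ -/

section Padic

variable {p ℓ : ℕ} [Fact p.Prime]

theorem mem_cycInt_iff (x : cycField p ℓ) : x ∈ cycInt p ℓ ↔ ‖(x : PadicAlgCl p)‖ ≤ 1 := by
  rw [cycInt, Valuation.mem_valuationSubring_iff]
  rfl

theorem norm_eq_one_of_isUnit {x : cycInt p ℓ} (hx : IsUnit x) :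
    ‖((x : cycField p ℓ) : PadicAlgCl p)‖ = 1 := by
  obtain ⟨y, hy⟩ := hx.exists_right_inv
  have h1 := (mem_cycInt_iff _).1 x.2
  have h2 := (mem_cycInt_iff _).1 y.2
  have h3 : ((x : cycField p ℓ) : PadicAlgCl p) * ((y : cycField p ℓ) : PadicAlgCl p) = 1 := by
    exact_mod_cast congrArg (fun z : cycInt p ℓ => ((z : cycField p ℓ) : PadicAlgCl p)) hy
  have h4 := congrArg norm h3
  rw [norm_mul, norm_one] at h4
  nlinarith [norm_nonneg ((x : cycField p ℓ) : PadicAlgCl p)]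

theorem norm_natCast_padicAlgCl (n : ℕ) : ‖(n : PadicAlgCl p)‖ = ‖(n : ℚ_[p])‖ := by
  rw [← map_natCast (algebraMap ℚ_[p] (PadicAlgCl p)), PadicAlgCl.norm_extends]

instance charP_residueField_cycInt : CharP (IsLocalRing.ResidueField (cycInt p ℓ)) p := by
  rw [CharP.charP_iff_prime_eq_zero Fact.out, ← map_natCast (IsLocalRing.residue (cycInt p ℓ)),
    IsLocalRing.residue_eq_zero_iff]
  intro h
  have h1 := norm_eq_one_of_isUnit h
  have h2 : (((p : cycInt p ℓ) : cycField p ℓ) : PadicAlgCl p) = p := by norm_cast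
  rw [h2, norm_natCast_padicAlgCl] at h1
  exact Padic.norm_p_lt_one.ne h1

variable [Fact ℓ.Prime]

/-- Pass to the residue field, of characteristic p; primitive roots remain primitive there because ℓ
≠ p. -/
theorem exists_noZerosFrom (hℓp : ℓ ≠ p) {g : AddMonoidAlgebra ℤ ℤ_[ℓ]} {a₀ : ℤ_[ℓ]}
    (ha₀ : ¬ (p : ℤ) ∣ g.coeff a₀) : ∃ N, NoZerosFrom p g N := by
  obtain ⟨N, hN⟩ := exists_forall_eval_ne_zero hℓp ha₀ (IsLocalRing.ResidueField (cycInt p ℓ))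
  refine ⟨N, fun i hi ξ hξ h => ?_⟩
  rw [← IsLocalRing.residue_eq_zero_iff, map_eval] at h
  refine hN i hi _ (hξ.map_of_natCast_ne_zero (NeZero.pos _) _ ?_) h
  rw [Nat.cast_pow]
  refine pow_ne_zero _ ?_
  rw [Ne, CharP.cast_eq_zero_iff _ p]
  exact fun h => hℓp ((Nat.prime_dvd_prime_iff_eq Fact.out Fact.out).1 h).symm

theorem NoZerosFrom.norm_eval_eq_one {g : AddMonoidAlgebra ℤ ℤ_[ℓ]} {N i : ℕ}
    (h : NoZerosFrom p g N) (hi : N ≤ i) {ξ : PadicAlgCl p} (hξ : IsPrimitiveRoot ξ (ℓ ^ i)) :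
    ‖eval i ξ g‖ = 1 := by
  have hmem : ξ ∈ cycField p ℓ := IntermediateField.subset_adjoin _ _ ⟨i, hξ.pow_eq_one⟩
  have hnorm : ‖ξ‖ = 1 := by
    have := congrArg norm hξ.pow_eq_one
    rw [norm_pow, norm_one] at this
    exact (pow_eq_one_iff_of_nonneg (norm_nonneg _) (NeZero.ne _)).1 this
  let ξ' : cycInt p ℓ := ⟨⟨ξ, hmem⟩, (mem_cycInt_iff _).2 hnorm.le⟩
  let φ : cycInt p ℓ →+* PadicAlgCl p :=
    (algebraMap (cycField p ℓ) (PadicAlgCl p)).comp (cycInt p ℓ).subtype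
  have hφ : Function.Injective φ := by
    rintro ⟨⟨a, ha⟩, ha'⟩ ⟨⟨b, hb⟩, hb'⟩ hab
    exact Subtype.ext (Subtype.ext hab)
  have hξ' : IsPrimitiveRoot ξ' (ℓ ^ i) := IsPrimitiveRoot.of_map_of_injective (f := φ) hξ hφ
  have h1 := h i hi ξ' hξ'
  rw [IsLocalRing.mem_maximalIdeal, mem_nonunits_iff, not_not] at h1
  have h2 := norm_eq_one_of_isUnit h1
  have h3 : φ (eval i ξ' g) = eval i ξ g := map_eval φ i ξ' g
  rw [← h3]
  exact h2

end Padic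

end GenPoly

/-! ### Splitting off the power of p -/

namespace GenPoly

theorem exists_eq_pow_mul {p : ℕ} [Fact p.Prime] {A : Type*} [AddCommMonoid A]
    {f : AddMonoidAlgebra ℤ A} (hf : f ≠ 0) :
    ∃ (μ : ℕ) (g : AddMonoidAlgebra ℤ A) (a₀ : A), mu p f = μ ∧
      f = (p : AddMonoidAlgebra ℤ A) ^ μ * g ∧ mu p g = 0 ∧ ¬ (p : ℤ) ∣ g.coeff a₀ := by
  obtain ⟨a₁, ha₁⟩ : ∃ a, f.coeff a ≠ 0 := by
    by_contra! h
    exact hf (AddMonoidAlgebra.ext (Finsupp.ext h))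
  -- The infimum is attained; at `a₀` the quotient `g` will have a coefficient prime to p.
  obtain ⟨a₀, ha₀⟩ : mu p f ∈ Set.range fun a => emultiplicity (p : ℤ) (f.coeff a) :=
    ciInf_mem (fun a => emultiplicity (p : ℤ) (f.coeff a))
  have hfin : mu p f ≠ ⊤ := by
    refine ne_top_of_le_ne_top ?_ (iInf_le _ a₁)
    exact finiteMultiplicity_iff_emultiplicity_ne_top.1
      (Int.finiteMultiplicity_iff.2 ⟨by simpa using (Fact.out : p.Prime).ne_one, ha₁⟩)
  obtain ⟨μ, hμ⟩ := ENat.ne_top_iff_exists.1 hfin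
  have hdvd : ∀ a, (p : ℤ) ^ μ ∣ f.coeff a := fun a =>
    pow_dvd_of_le_emultiplicity (hμ.trans_le (iInf_le _ a))
  let g : AddMonoidAlgebra ℤ A :=
    .ofCoeff (f.coeff.mapRange (fun c => c / (p : ℤ) ^ μ) (Int.zero_ediv _))
  have hg : ∀ a, f.coeff a = (p : ℤ) ^ μ * g.coeff a := fun a => by
    simp [g, Int.mul_ediv_cancel' (hdvd a)]
  have ha₀' : ¬ (p : ℤ) ∣ g.coeff a₀ := by
    rintro ⟨c, hc⟩
    have h1 : (p : ℤ) ^ (μ + 1) ∣ f.coeff a₀ := ⟨c, by rw [hg, hc]; ring⟩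
    have h2 := le_emultiplicity_of_pow_dvd h1
    have h3 : emultiplicity (p : ℤ) (f.coeff a₀) = μ := ha₀.trans hμ.symm
    rw [h3, Nat.cast_le] at h2
    omega
  refine ⟨μ, g, a₀, hμ.symm, AddMonoidAlgebra.ext (Finsupp.ext fun a => ?_), ?_, ha₀'⟩
  · have h : (p : AddMonoidAlgebra ℤ A) ^ μ * g = (p ^ μ) • g := by
      rw [nsmul_eq_mul, Nat.cast_pow]
    rw [h, AddMonoidAlgebra.coeff_smul, Finsupp.smul_apply, nsmul_eq_mul, Nat.cast_pow, hg a]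
  · refine le_antisymm ?_ zero_le
    exact (iInf_le _ a₀).trans_eq (emultiplicity_eq_zero.2 ha₀')

end GenPoly

/-! ### The growth law for derived towers -/

namespace Multigraph

variable {X : Multigraph.{u, v}} {S : Set X.E}

open scoped Classical in
theorem _root_.finsum_subtype_eq_sum_ite {ι A : Type*} [Fintype ι] [AddCommMonoid A]
    (P : ι → Prop) (f : ι → A) : ∑ᶠ i : {i // P i}, f i = ∑ i, if P i then f i else 0 := by
  rw [finsum_eq_sum_of_fintype, ← Finset.sum_filter]
  exact (Finset.sum_subtype _ (by simp) _).symm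

variable {ℓ : ℕ} [Fact ℓ.Prime]

theorem genMatrix_apply (hS : X.IsSection S) (α : S → ℤ_[ℓ]) (x y : X.V) :
    X.genMatrix α x y = ∑ e, (if x = X.src e then (1 : AddMonoidAlgebra ℤ ℤ_[ℓ]) else 0) *
      ((if y = X.src e then 1 else 0) -
        (if y = X.tgt e then AddMonoidAlgebra.single (X.extend hS α e) 1 else 0)) := by
  classical
  simp only [mul_sub, Finset.sum_sub_distrib]
  rw [← ite_valency_eq_sum, hS.sum_eq, genMatrix, Matrix.sub_apply, Matrix.diagonal_apply,
    Matrix.of_apply, finsum_subtype_eq_sum_ite (fun s : S => X.src s = x ∧ X.tgt s = y)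
      (fun s => AddMonoidAlgebra.single (α s) (1 : ℤ)),
    finsum_subtype_eq_sum_ite (fun s : S => X.src s = y ∧ X.tgt s = x)
      (fun s => AddMonoidAlgebra.single (-α s) (1 : ℤ)), ← Finset.sum_add_distrib]
  congr 1
  refine Finset.sum_congr rfl fun s _ => ?_
  have hs : X.extend hS α s = α s := by simp [extend]
  rw [extend_inv, hs, X.src_inv, X.tgt_inv, ite_zero_mul, ite_zero_mul, one_mul, one_mul,
    ← ite_and, ← ite_and]
  congr 1 <;> congr 1 <;> simp only [eq_comm, and_comm]

theorem eval_genPoly (hS : X.IsSection S) (α : S → ℤ_[ℓ]) {R : Type*} [CommRing R] (n : ℕ)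
    {ξ : R} (hξ : ξ ^ ℓ ^ n = 1) :
    GenPoly.eval n ξ (X.genPoly α) = (twistedLaplacian hS (voltage α n) ξ).det := by
  rw [← GenPoly.evalHom_apply n ξ hξ, genPoly, RingHom.map_det]
  congr 1
  ext x y
  rw [RingHom.mapMatrix_apply, Matrix.map_apply, genMatrix_apply hS, map_sum, twistedLaplacian,
    Matrix.of_apply]
  refine Finset.sum_congr rfl fun e _ => ?_
  have h : X.extend hS (voltage α n) e = PadicInt.toZModPow n (X.extend hS α e) :=
    extend_map X hS _ α e
  rw [h, map_mul, map_sub, apply_ite (GenPoly.evalHom n ξ hξ), apply_ite (GenPoly.evalHom n ξ hξ),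
    apply_ite (GenPoly.evalHom n ξ hξ), GenPoly.evalHom_single, map_one, map_zero]

theorem _root_.IsAlgClosed.exists_isPrimitiveRoot (K : Type*) [Field K] [IsAlgClosed K]
    [CharZero K] {N : ℕ} (hN : N ≠ 0) : ∃ ζ : K, IsPrimitiveRoot ζ N := by
  have : NeZero (N : K) := ⟨Nat.cast_ne_zero.2 hN⟩
  obtain ⟨ζ, hζ⟩ := IsAlgClosed.exists_root (Polynomial.cyclotomic N K) (by
    rw [Polynomial.degree_cyclotomic]
    exact_mod_cast (Nat.totient_pos.2 (Nat.pos_of_ne_zero hN)).ne')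
  exact ⟨ζ, Polynomial.isRoot_cyclotomic_iff.1 hζ⟩

theorem _root_.Polynomial.nthRootsFinset_prime_pow_succ {K : Type*} [Field K] [DecidableEq K]
    {ℓ : ℕ} (hℓ : ℓ.Prime) (n : ℕ) :
    (Polynomial.nthRootsFinset (ℓ ^ (n + 1)) (1 : K)).erase 1 =
      (Polynomial.nthRootsFinset (ℓ ^ n) (1 : K)).erase 1 ∪ primitiveRoots (ℓ ^ (n + 1)) K := by
  have := Fact.mk hℓ
  ext ξ
  rw [Finset.mem_union, Finset.mem_erase, Finset.mem_erase,
    Polynomial.mem_nthRootsFinset (pow_pos hℓ.pos _),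
    Polynomial.mem_nthRootsFinset (pow_pos hℓ.pos _), mem_primitiveRoots (pow_pos hℓ.pos _)]
  constructor
  · rintro ⟨h1, h2⟩
    by_cases h3 : ξ ^ ℓ ^ n = 1
    · exact .inl ⟨h1, h3⟩
    · exact .inr (orderOf_eq_prime_pow h3 h2 ▸ IsPrimitiveRoot.orderOf ξ)
  · rintro (⟨h1, h2⟩ | h)
    · exact ⟨h1, by rw [pow_succ, pow_mul, h2, one_pow]⟩
    · exact ⟨h.ne_one (one_lt_pow₀ hℓ.one_lt n.succ_ne_zero), h.pow_eq_one⟩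

theorem _root_.Polynomial.disjoint_nthRootsFinset_primitiveRoots {K : Type*} [Field K]
    [DecidableEq K] {ℓ : ℕ} (hℓ : ℓ.Prime) (n : ℕ) :
    Disjoint ((Polynomial.nthRootsFinset (ℓ ^ n) (1 : K)).erase 1)
      (primitiveRoots (ℓ ^ (n + 1)) K) := by
  refine Finset.disjoint_left.2 fun ξ h1 h2 => ?_
  rw [Finset.mem_erase, Polynomial.mem_nthRootsFinset (pow_pos hℓ.pos _)] at h1
  have h3 := (isPrimitiveRoot_of_mem_primitiveRoots h2).dvd_of_pow_eq_one _ h1.2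
  exact absurd (Nat.le_of_dvd (pow_pos hℓ.pos _) h3)
    (not_le.2 (Nat.pow_lt_pow_right hℓ.one_lt n.lt_succ_self))

/-- Compares the product formulas at two consecutive levels. The factor at ξ = 1 is the same in both
and is absorbed by substitution, so it need not be known to be nonzero. -/
theorem numSpanningTrees_derived_succ {K : Type*} [Field K] [CharZero K] [IsAlgClosed K]
    [Nonempty X.V] (hS : X.IsSection S) (α : S → ℤ_[ℓ]) (n : ℕ) :
    (ℓ : K) * (X.derived hS (voltage α (n + 1))).numSpanningTrees =
      (X.derived hS (voltage α n)).numSpanningTrees *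
        ∏ ξ ∈ primitiveRoots (ℓ ^ (n + 1)) K, GenPoly.eval (n + 1) ξ (X.genPoly α) := by
  classical
  have hℓ : ℓ.Prime := Fact.out
  have hform : ∀ n, (Fintype.card X.V : K) ^ 2 * (ℓ ^ n : ℕ) *
      (X.derived hS (voltage α n)).numSpanningTrees =
      (twistedLaplacian hS (voltage α 0) (1 : K) + Matrix.of fun _ _ => 1).det *
        ∏ ξ ∈ (Polynomial.nthRootsFinset (ℓ ^ n) (1 : K)).erase 1,
          GenPoly.eval n ξ (X.genPoly α) := by
    intro n
    obtain ⟨ζ, hζ⟩ := IsAlgClosed.exists_isPrimitiveRoot K (NeZero.ne (ℓ ^ n))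
    rw [prod_det_twistedLaplacian hS (voltage α n) hζ]
    have h1 : twistedLaplacian hS (voltage α n) (1 : K) =
        twistedLaplacian hS (voltage α 0) (1 : K) := by
      ext x y
      simp [twistedLaplacian]
    rw [h1]
    congr 1
    refine Finset.prod_congr rfl fun ξ hξ => ?_
    rw [Finset.mem_erase, Polynomial.mem_nthRootsFinset (NeZero.pos _)] at hξ
    rw [eval_genPoly hS α n hξ.2]
  have h0 := hform n
  have h1 := hform (n + 1)
  rw [Polynomial.nthRootsFinset_prime_pow_succ hℓ,
    Finset.prod_union (Polynomial.disjoint_nthRootsFinset_primitiveRoots hℓ n), ← mul_assoc] at h1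
  have h2 : ∏ ξ ∈ (Polynomial.nthRootsFinset (ℓ ^ n) (1 : K)).erase 1,
      GenPoly.eval (n + 1) ξ (X.genPoly α) =
      ∏ ξ ∈ (Polynomial.nthRootsFinset (ℓ ^ n) (1 : K)).erase 1,
        GenPoly.eval n ξ (X.genPoly α) := by
    refine Finset.prod_congr rfl fun ξ hξ => ?_
    rw [Finset.mem_erase, Polynomial.mem_nthRootsFinset (NeZero.pos _)] at hξ
    exact GenPoly.eval_eq_of_le n.le_succ hξ.2 _
  rw [h2, ← h0] at h1
  have hc : (Fintype.card X.V : K) ^ 2 * (ℓ ^ n : ℕ) ≠ 0 := by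
    refine mul_ne_zero (pow_ne_zero _ (by simp)) (Nat.cast_ne_zero.2 (NeZero.ne _))
  refine mul_left_cancel₀ hc ?_
  push_cast at h1 ⊢
  linear_combination h1

/-- If f = 0, the product over the primitive ℓ-th roots vanishes, whereas the first layer is
connected and has a spanning tree. -/
theorem genPoly_ne_zero (hS : X.IsSection S) (α : S → ℤ_[ℓ])
    (h : ∀ n, ((X.derivedTower hS α).graph n).Connected) : X.genPoly α ≠ 0 := by
  intro h0
  have : Nonempty X.V := (h 0).1.map Prod.fst
  have hℓ : ℓ.Prime := Fact.out
  have h1 := numSpanningTrees_derived_succ (K := AlgebraicClosure ℚ) hS α 0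
  obtain ⟨ζ, hζ⟩ := IsAlgClosed.exists_isPrimitiveRoot (AlgebraicClosure ℚ)
    (NeZero.ne (ℓ ^ (0 + 1)))
  rw [Finset.prod_eq_zero ((mem_primitiveRoots (NeZero.pos _)).2 hζ) (by simp [h0, GenPoly.eval]),
    mul_zero] at h1
  refine mul_ne_zero (Nat.cast_ne_zero.2 hℓ.ne_zero) ?_ h1
  exact Nat.cast_ne_zero.2 (h 1).numSpanningTrees_ne_zero

theorem _root_.Padic.norm_natCast_eq_zpow {p : ℕ} [Fact p.Prime] {n : ℕ} (hn : n ≠ 0) :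
    ‖(n : ℚ_[p])‖ = (p : ℝ) ^ (-(padicValNat p n : ℤ)) := by
  rw [Padic.norm_eq_zpow_neg_valuation (Nat.cast_ne_zero.2 hn), Padic.valuation_natCast]

theorem growth_derivedTower {p : ℕ} [Fact p.Prime] (hℓp : ℓ ≠ p) (hS : X.IsSection S)
    (α : S → ℤ_[ℓ]) (h : ∀ n, ((X.derivedTower hS α).graph n).Connected) :
    GenPoly.Growth p (X.genPoly α)
      (fun n => ((X.derivedTower hS α).graph n).numSpanningTrees) := by
  have hℓ : ℓ.Prime := Fact.out
  have hp : p.Prime := Fact.out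
  have : Nonempty X.V := (h 0).1.map Prod.fst
  obtain ⟨μ, g, a₀, hμ, hfg, hg, ha₀⟩ :=
    GenPoly.exists_eq_pow_mul (p := p) (genPoly_ne_zero hS α h)
  obtain ⟨N, hN⟩ := GenPoly.exists_noZerosFrom hℓp ha₀
  have hne : {N : ℕ | 1 ≤ N ∧ GenPoly.NoZerosFrom p g N}.Nonempty :=
    ⟨N + 1, Nat.le_add_left _ _, fun i hi => hN i (by omega)⟩
  refine ⟨μ, g, hμ, hfg, hg, _, ⟨Nat.sInf_mem hne, fun M hM => Nat.sInf_le hM⟩, ?_⟩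
  set n₀ := sInf {N : ℕ | 1 ≤ N ∧ GenPoly.NoZerosFrom p g N}
  have hn₀ : GenPoly.NoZerosFrom p g n₀ := (Nat.sInf_mem hne).2
  set κ : ℕ → ℕ := fun n => ((X.derivedTower hS α).graph n).numSpanningTrees
  have hκ : ∀ n, κ n ≠ 0 := fun n => (h n).numSpanningTrees_ne_zero
  have hpR : (p : ℝ) ≠ 0 := Nat.cast_ne_zero.2 hp.ne_zero
  -- Take p-adic absolute values in the recursion: ℓ has absolute value 1, and each of the φ(ℓⁿ⁺¹)
  -- values of f has absolute value p^(-μ).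
  have hstep : ∀ n, n₀ ≤ n → (padicValNat p (κ (n + 1)) : ℤ) =
      padicValNat p (κ n) + μ * ((ℓ : ℤ) ^ (n + 1) - (ℓ : ℤ) ^ n) := by
    intro n hn
    have h0 : (ℓ : PadicAlgCl p) * (κ (n + 1) : ℕ) = (κ n : ℕ) *
        ∏ ξ ∈ primitiveRoots (ℓ ^ (n + 1)) (PadicAlgCl p),
          GenPoly.eval (n + 1) ξ (X.genPoly α) := numSpanningTrees_derived_succ hS α n
    have h1 := congrArg norm h0
    have h2 : ∀ ξ ∈ primitiveRoots (ℓ ^ (n + 1)) (PadicAlgCl p),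
        ‖GenPoly.eval (n + 1) ξ (X.genPoly α)‖ = (p : ℝ) ^ (-(μ : ℤ)) := by
      intro ξ hξ
      have hξ' := isPrimitiveRoot_of_mem_primitiveRoots hξ
      rw [← GenPoly.evalHom_apply _ _ hξ'.pow_eq_one, hfg, map_mul, map_pow, map_natCast,
        GenPoly.evalHom_apply, norm_mul, norm_pow, hn₀.norm_eval_eq_one (by omega) hξ', mul_one,
        GenPoly.norm_natCast_padicAlgCl, Padic.norm_p, inv_pow, zpow_neg, zpow_natCast]
    obtain ⟨ζ, hζ⟩ := IsAlgClosed.exists_isPrimitiveRoot (PadicAlgCl p)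
      (NeZero.ne (ℓ ^ (n + 1)))
    rw [norm_mul, norm_mul, norm_prod, Finset.prod_congr rfl h2, Finset.prod_const,
      hζ.card_primitiveRoots, Nat.totient_prime_pow_succ hℓ, GenPoly.norm_natCast_padicAlgCl,
      GenPoly.norm_natCast_padicAlgCl, GenPoly.norm_natCast_padicAlgCl,
      Padic.norm_natCast_eq_zpow hℓ.ne_zero, Padic.norm_natCast_eq_zpow (hκ n),
      Padic.norm_natCast_eq_zpow (hκ (n + 1)), ← zpow_natCast, ← zpow_mul, ← zpow_add₀ hpR,
      ← zpow_add₀ hpR, padicValNat_primes hℓp.symm] at h1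
    have h3 := zpow_right_injective₀ (by exact_mod_cast hp.pos) (by exact_mod_cast hp.ne_one) h1
    rw [Nat.cast_mul, Nat.cast_pow, Nat.cast_sub hℓ.one_le, Nat.cast_one, Nat.cast_zero] at h3
    rw [pow_succ]
    linear_combination -h3
  refine ⟨padicValNat p (κ n₀) - μ * (ℓ : ℤ) ^ n₀, fun n hn => ?_⟩
  induction n, hn using Nat.le_induction with
  | base => ring
  | succ n hn ih =>
    rw [hstep n hn, ih]
    ring

end Multigraph

/-! ### Compatible choices along inverse systems -/

theorem exists_dependent_seq {A : ℕ → Type*} (R : ∀ n, A n → A (n + 1) → Prop) (a : A 0)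
    (h : ∀ n a, ∃ b, R n a b) : ∃ f : ∀ n, A n, ∀ n, R n (f n) (f (n + 1)) := by
  choose s hs using h
  exact ⟨fun n => Nat.rec a s n, fun n => hs n _⟩

/-- In the given coordinates ρ is reduction times a unit of ℤ/nℤ. That unit lifts to ℤ/mℤ, and
multiplying `eA` by the lift turns ρ into plain reduction. -/
theorem exists_mulEquiv_zmod_of_surjective {A B : Type*} [Group A] [Group B] {m n : ℕ} [NeZero m]
    [NeZero n] (hnm : n ∣ m) (ρ : A →* B) (hρ : Function.Surjective ρ)
    (eA : A ≃* Multiplicative (ZMod m)) (eB : B ≃* Multiplicative (ZMod n)) :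
    ∃ e : A ≃* Multiplicative (ZMod m), ∀ a,
      (eB (ρ a)).toAdd = ZMod.castHom hnm (ZMod n) (e a).toAdd := by
  let φ : ZMod m →+ ZMod n := AddMonoidHom.mk'
    (fun x => (eB (ρ (eA.symm (Multiplicative.ofAdd x)))).toAdd) fun x y => by simp
  have hφ : ∀ x, φ x = ZMod.castHom hnm (ZMod n) x * φ 1 := by
    intro x
    have h1 : x = x.val • (1 : ZMod m) := by simp
    conv_lhs => rw [h1]
    rw [map_nsmul, nsmul_eq_mul, ZMod.castHom_apply, ZMod.cast_eq_val]
  obtain ⟨x, hx⟩ : ∃ x, φ x = 1 := by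
    obtain ⟨a, ha⟩ := hρ (eB.symm (Multiplicative.ofAdd 1))
    exact ⟨(eA a).toAdd, by simp [φ, ha]⟩
  have hu : IsUnit (φ 1) := IsUnit.of_mul_eq_one_right _ ((hφ x).symm.trans hx)
  obtain ⟨u, hu⟩ := hu
  obtain ⟨w, rfl⟩ := ZMod.unitsMap_surjective hnm u
  refine ⟨eA.trans (AddEquiv.toMultiplicative (AddAut.mulLeft w).toAdd), fun a => ?_⟩
  have h2 : (eB (ρ a)).toAdd = φ (eA a).toAdd := by simp [φ]
  rw [h2, hφ, ← hu]
  have h3 : ((eA.trans (AddEquiv.toMultiplicative (AddAut.mulLeft w).toAdd)) a).toAdd =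
      w * (eA a).toAdd := rfl
  rw [h3, map_mul, mul_comm]
  rfl

theorem PadicInt.exists_toZModPow_eq {ℓ : ℕ} [Fact ℓ.Prime] (a : ∀ n, ZMod (ℓ ^ n))
    (h : ∀ n, ZMod.castHom (pow_dvd_pow ℓ n.le_succ) (ZMod (ℓ ^ n)) (a (n + 1)) = a n) :
    ∃ z : ℤ_[ℓ], ∀ n, PadicInt.toZModPow n z = a n := by
  have hd : ∀ i, (ℓ : ℤ) ^ i ∣ ((a (i + 1)).val : ℤ) - ((a i).val : ℤ) := by
    intro i
    have h1 : (((a i).val : ℤ) : ZMod (ℓ ^ i)) = ((a (i + 1)).val : ℤ) := by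
      rw [Int.cast_natCast, Int.cast_natCast, ZMod.natCast_zmod_val, ← h i, ZMod.castHom_apply,
        ZMod.cast_eq_val]
    rw [ZMod.intCast_eq_intCast_iff_dvd_sub] at h1
    exact_mod_cast h1
  refine ⟨_, fun n => (PadicInt.toZModPow_ofIntSeq_of_pow_dvd_sub
    (fun i => ((a i).val : ℤ)) ℓ hd n).trans ?_⟩
  rw [Int.cast_natCast, ZMod.natCast_zmod_val]

/-! ### Covers and covering transformations -/

namespace Multigraph

namespace Hom

variable {X Y Z : Multigraph.{u, v}}

theorem IsCover.eq_of_src_eq {f : Hom Y X} (hf : f.IsCover) {e e' : Y.E}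
    (hs : Y.src e = Y.src e') (h : f.onE e = f.onE e') : e = e' := by
  obtain ⟨e₀, -, hu⟩ := hf.2 (Y.src e) (f.onE e) (f.src_onE e)
  rw [hu e ⟨rfl, rfl⟩, hu e' ⟨hs.symm, h.symm⟩]

/-- Uniqueness of lifts along a cover. -/
theorem IsCover.eq_of_comp_eq {f : Hom Y X} (hf : f.IsCover) (hZ : Z.Connected) {a b : Hom Z Y}
    (h : f.comp a = f.comp b) {z : Z.V} (hz : a.onV z = b.onV z) : a = b := by
  have hE : ∀ e, a.onV (Z.src e) = b.onV (Z.src e) → a.onE e = b.onE e := fun e he =>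
    hf.eq_of_src_eq (by rw [a.src_onE, b.src_onE, he]) (congrFun (congrArg Hom.onE h) e)
  have hV : ∀ y, a.onV y = b.onV y := by
    intro y
    obtain ⟨w, hw, -⟩ := hZ.2 z y
    induction w generalizing z with
    | nil => rwa [← show z = y from hw]
    | cons e w ih =>
      obtain ⟨rfl, hw⟩ := hw
      refine ih ?_ hw
      rw [← a.tgt_onE, ← b.tgt_onE, hE e hz]
  exact Hom.ext (funext hV) (funext fun e => hE e (hV _))

/-- A covering transformation as a morphism. -/
def ofDeck {f : Hom Y X} (σ : f.deckGroup) : Hom Y Y where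
  onV := σ.1.1
  onE := σ.1.2
  src_onE := σ.2.1
  tgt_onE := σ.2.2.1
  onE_inv := σ.2.2.2.1

theorem comp_ofDeck {f : Hom Y X} (σ : f.deckGroup) : f.comp (ofDeck σ) = f :=
  Hom.ext (funext σ.2.2.2.2.1) (funext σ.2.2.2.2.2)

theorem ofDeck_mul {f : Hom Y X} (σ τ : f.deckGroup) :
    ofDeck (σ * τ) = (ofDeck σ).comp (ofDeck τ) := rfl

theorem ofDeck_one {f : Hom Y X} : ofDeck (1 : f.deckGroup) = Hom.id Y := rfl

theorem ofDeck_injective {f : Hom Y X} : Function.Injective (ofDeck (f := f)) := by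
  intro σ τ h
  exact Subtype.ext (Prod.ext (Equiv.ext fun y => congrFun (congrArg Hom.onV h) y)
    (Equiv.ext fun e => congrFun (congrArg Hom.onE h) e))

theorem IsCover.ofDeck_free {f : Hom Y X} (hf : f.IsCover) (hY : Y.Connected) {σ τ : f.deckGroup}
    {y : Y.V} (h : (ofDeck σ).onV y = (ofDeck τ).onV y) : σ = τ :=
  ofDeck_injective (hf.eq_of_comp_eq hY ((comp_ofDeck σ).trans (comp_ofDeck τ).symm) h)

theorem comp_assoc {W : Multigraph.{u, v}} (f : Hom Y X) (g : Hom Z Y) (h : Hom W Z) :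
    (f.comp g).comp h = f.comp (g.comp h) := rfl

end Hom

namespace Tower

open Hom

variable {ℓ : ℕ} {T : Tower.{u, v}}

/-- The Galois property gives τ with the right value at one vertex; uniqueness of lifts from a
connected multigraph makes the two morphisms agree everywhere. -/
theorem IsAbelian.exists_deck_comp (hT : T.IsAbelian ℓ) (n : ℕ)
    (σ : (T.toBase (n + 1)).deckGroup) :
    ∃ τ : (T.toBase n).deckGroup, (ofDeck τ).comp (T.map n) = (T.map n).comp (ofDeck σ) := by
  obtain ⟨y⟩ := (hT.connected (n + 1)).1
  have hσ : ((T.toBase n).comp (T.map n)).comp (ofDeck σ) = (T.toBase n).comp (T.map n) :=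
    comp_ofDeck σ
  obtain ⟨τ, hτ, h⟩ := (hT.galois n).2 ((T.map n).onV y) ((T.map n).onV ((ofDeck σ).onV y))
    (congrFun (congrArg Hom.onV hσ) y).symm
  refine ⟨⟨τ, hτ⟩, (hT.galois n).1.eq_of_comp_eq (hT.connected (n + 1)) ?_ (z := y) h⟩
  rw [← comp_assoc, comp_ofDeck, ← comp_assoc, hσ]

theorem IsAbelian.deck_ext (hT : T.IsAbelian ℓ) (n : ℕ) {τ τ' : (T.toBase n).deckGroup}
    (h : (ofDeck τ).comp (T.map n) = (ofDeck τ').comp (T.map n)) : τ = τ' := by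
  obtain ⟨y⟩ := (hT.connected (n + 1)).1
  exact (hT.galois n).1.ofDeck_free (hT.connected n) (congrFun (congrArg Hom.onV h) y)

theorem IsAbelian.exists_deckHom (hT : T.IsAbelian ℓ) (n : ℕ) :
    ∃ ρ : (T.toBase (n + 1)).deckGroup →* (T.toBase n).deckGroup, Function.Surjective ρ ∧
      ∀ σ, (ofDeck (ρ σ)).comp (T.map n) = (T.map n).comp (ofDeck σ) := by
  choose ρ hρ using hT.exists_deck_comp n
  refine ⟨MonoidHom.mk' ρ fun σ τ => hT.deck_ext n ?_, fun τ => ?_, hρ⟩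
  · rw [hρ, ofDeck_mul, ofDeck_mul, comp_assoc, hρ, ← comp_assoc, ← comp_assoc, hρ]
  · obtain ⟨y⟩ := (hT.connected (n + 1)).1
    obtain ⟨y', hy'⟩ := (hT.cover n).1 ((ofDeck τ).onV ((T.map n).onV y))
    have h1 : (T.toBase (n + 1)).onV y = (T.toBase (n + 1)).onV y' := by
      change (T.toBase n).onV ((T.map n).onV y) = (T.toBase n).onV ((T.map n).onV y')
      rw [hy']
      exact (congrFun (congrArg Hom.onV (comp_ofDeck τ)) _).symm
    obtain ⟨σ, hσ, h⟩ := (hT.galois (n + 1)).2 y y' h1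
    refine ⟨⟨σ, hσ⟩, (hT.galois n).1.ofDeck_free (hT.connected n) (y := (T.map n).onV y) ?_⟩
    rw [← hy', ← h]
    exact congrFun (congrArg Hom.onV (hρ ⟨σ, hσ⟩)) y

/-- A compatible family of free actions of `ℤ/ℓⁿℤ` on the members of a tower that are transitive
on the fibres over the base. -/
structure CyclicAction (ℓ : ℕ) (T : Tower.{u, v}) where
  act : ∀ n, ZMod (ℓ ^ n) → Hom (T.graph n) (T.graph n)
  act_zero : ∀ n, act n 0 = Hom.id _
  act_add : ∀ n a b, act n (a + b) = (act n a).comp (act n b)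
  toBase_comp : ∀ n a, (T.toBase n).comp (act n a) = T.toBase n
  free : ∀ n a b y, (act n a).onV y = (act n b).onV y → a = b
  transitive : ∀ n y y', (T.toBase n).onV y = (T.toBase n).onV y' → ∃ a, (act n a).onV y = y'
  map_comp : ∀ n a, (T.map n).comp (act (n + 1) a) =
    (act n (ZMod.castHom (pow_dvd_pow ℓ n.le_succ) (ZMod (ℓ ^ n)) a)).comp (T.map n)

theorem IsAbelian.nonempty_cyclicAction [Fact ℓ.Prime] (hT : T.IsAbelian ℓ) :
    Nonempty (CyclicAction ℓ T) := by
  choose ρ hρs hρ using hT.exists_deckHom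
  -- Each identification is corrected against the one chosen at the level below, so that restriction
  -- of covering transformations becomes reduction modulo ℓⁿ.
  obtain ⟨E, hE⟩ := exists_dependent_seq
    (A := fun n => (T.toBase n).deckGroup ≃* Multiplicative (ZMod (ℓ ^ n)))
    (fun n e e' => ∀ σ, (e (ρ n σ)).toAdd =
      ZMod.castHom (pow_dvd_pow ℓ n.le_succ) (ZMod (ℓ ^ n)) (e' σ).toAdd)
    (hT.group 0).some fun n e => exists_mulEquiv_zmod_of_surjective
      (pow_dvd_pow ℓ n.le_succ) (ρ n) (hρs n) (hT.group (n + 1)).some e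
  refine ⟨⟨fun n a => ofDeck ((E n).symm (Multiplicative.ofAdd a)), ?_, ?_, ?_, ?_, ?_, ?_⟩⟩
  · intro n
    rw [ofAdd_zero, map_one, ofDeck_one]
  · intro n a b
    rw [ofAdd_add, map_mul, ofDeck_mul]
  · intro n a
    exact comp_ofDeck _
  · intro n a b y h
    exact Multiplicative.ofAdd.injective ((E n).symm.injective
      ((hT.galois n).1.ofDeck_free (hT.connected n) h))
  · intro n y y' h
    obtain ⟨σ, hσ, h⟩ := (hT.galois n).2 y y' h
    refine ⟨(E n ⟨σ, hσ⟩).toAdd, ?_⟩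
    rw [ofAdd_toAdd, MulEquiv.symm_apply_apply]
    exact h
  · intro n a
    rw [← hρ]
    congr 2
    rw [MulEquiv.eq_symm_apply]
    have := hE n ((E (n + 1)).symm (Multiplicative.ofAdd a))
    rw [MulEquiv.apply_symm_apply, toAdd_ofAdd] at this
    rw [← this, ofAdd_toAdd]

end Tower

end Multigraph

/-! ### Voltages: abelian towers are derived towers -/

namespace Multigraph

namespace Tower

open Hom

variable {ℓ : ℕ} {T : Tower.{u, v}}

namespace CyclicAction

variable (A : CyclicAction ℓ T)

theorem toBase_onV (n : ℕ) (a : ZMod (ℓ ^ n)) (y : (T.graph n).V) :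
    (T.toBase n).onV ((A.act n a).onV y) = (T.toBase n).onV y :=
  congrFun (congrArg Hom.onV (A.toBase_comp n a)) y

theorem toBase_onE (n : ℕ) (a : ZMod (ℓ ^ n)) (e : (T.graph n).E) :
    (T.toBase n).onE ((A.act n a).onE e) = (T.toBase n).onE e :=
  congrFun (congrArg Hom.onE (A.toBase_comp n a)) e

theorem act_add_onV (n : ℕ) (a b : ZMod (ℓ ^ n)) (y : (T.graph n).V) :
    (A.act n (a + b)).onV y = (A.act n a).onV ((A.act n b).onV y) :=
  congrFun (congrArg Hom.onV (A.act_add n a b)) y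

theorem act_add_onE (n : ℕ) (a b : ZMod (ℓ ^ n)) (e : (T.graph n).E) :
    (A.act n (a + b)).onE e = (A.act n a).onE ((A.act n b).onE e) :=
  congrFun (congrArg Hom.onE (A.act_add n a b)) e

theorem act_zero_onV (n : ℕ) (y : (T.graph n).V) : (A.act n 0).onV y = y :=
  congrFun (congrArg Hom.onV (A.act_zero n)) y

theorem map_onV (n : ℕ) (a : ZMod (ℓ ^ (n + 1))) (y : (T.graph (n + 1)).V) :
    (T.map n).onV ((A.act (n + 1) a).onV y) =
      (A.act n (ZMod.castHom (pow_dvd_pow ℓ n.le_succ) (ZMod (ℓ ^ n)) a)).onV ((T.map n).onV y) :=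
  congrFun (congrArg Hom.onV (A.map_comp n a)) y

theorem map_onE (n : ℕ) (a : ZMod (ℓ ^ (n + 1))) (e : (T.graph (n + 1)).E) :
    (T.map n).onE ((A.act (n + 1) a).onE e) =
      (A.act n (ZMod.castHom (pow_dvd_pow ℓ n.le_succ) (ZMod (ℓ ^ n)) a)).onE ((T.map n).onE e) :=
  congrFun (congrArg Hom.onE (A.map_comp n a)) e

theorem neg_add_onV (n : ℕ) (a : ZMod (ℓ ^ n)) (y : (T.graph n).V) :
    (A.act n (-a)).onV ((A.act n a).onV y) = y := by
  rw [← A.act_add_onV, neg_add_cancel, A.act_zero_onV]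

end CyclicAction

theorem IsAbelian.exists_section (hT : T.IsAbelian ℓ) :
    ∃ s : ∀ n, (T.graph 0).V → (T.graph n).V, (∀ n x, (T.toBase n).onV (s n x) = x) ∧
      ∀ n x, (T.map n).onV (s (n + 1) x) = s n x := by
  obtain ⟨f, hf⟩ := exists_dependent_seq
    (A := fun n => {s : (T.graph 0).V → (T.graph n).V // ∀ x, (T.toBase n).onV (s x) = x})
    (fun n s t => ∀ x, (T.map n).onV (t.1 x) = s.1 x) ⟨fun x => x, fun _ => rfl⟩ fun n s => by
      choose t ht using fun x => (hT.cover n).1 (s.1 x)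
      refine ⟨⟨t, fun x => ?_⟩, ht⟩
      change (T.toBase n).onV ((T.map n).onV (t x)) = x
      rw [ht, s.2]
  exact ⟨fun n => (f n).1, fun n => (f n).2, hf⟩

/-- Every abelian tower is isomorphic to a tower of derived multigraphs. -/
theorem IsAbelian.exists_isoDerived [Fact ℓ.Prime] (hT : T.IsAbelian ℓ)
    {S : Set (T.graph 0).E} (hS : (T.graph 0).IsSection S) :
    ∃ α : S → ℤ_[ℓ], T.IsoDerived hS α := by
  obtain ⟨A⟩ := hT.nonempty_cyclicAction
  obtain ⟨s, hs, hmap⟩ := hT.exists_section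
  -- `L n e` is the lift of `e` that starts on the chosen section; `V n e` measures how far its end
  -- is from the section.
  have hlift : ∀ n e, ∃ e', (T.graph n).src e' = s n ((T.graph 0).src e) ∧
      (T.toBase n).onE e' = e := fun n e =>
    ((hT.galois n).1.2 (s n ((T.graph 0).src e)) e (hs n _).symm).exists
  choose L hLsrc hLbase using hlift
  have hLuniq : ∀ n {e e'}, (T.graph n).src e' = s n ((T.graph 0).src e) →
      (T.toBase n).onE e' = e → e' = L n e := fun n e e' h1 h2 =>
    (hT.galois n).1.eq_of_src_eq (h1.trans (hLsrc n e).symm) (h2.trans (hLbase n e).symm)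
  have hvolt : ∀ n e, ∃ a, (A.act n a).onV (s n ((T.graph 0).tgt e)) =
      (T.graph n).tgt (L n e) := fun n e => A.transitive n _ _ (by
        rw [hs, ← (T.toBase n).tgt_onE, hLbase])
  choose V hV using hvolt
  -- The reversed lift ends over the origin of `e` but starts off the section by `V n e`;
  -- translating back gives the unique lift on the section.
  have hLinv : ∀ n e, L n ((T.graph 0).inv e) =
      (A.act n (-V n e)).onE ((T.graph n).inv (L n e)) := by
    intro n e
    refine (hLuniq n ?_ ?_).symm
    · rw [(A.act n _).src_onE, (T.graph n).src_inv, (T.graph 0).src_inv, ← hV, A.neg_add_onV]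
    · rw [A.toBase_onE, (T.toBase n).onE_inv, hLbase]
  have hVinv : ∀ n e, V n ((T.graph 0).inv e) = -V n e := by
    intro n e
    refine A.free n _ _ (s n ((T.graph 0).tgt ((T.graph 0).inv e))) ?_
    rw [hV, hLinv, (A.act n _).tgt_onE, (T.graph n).tgt_inv, (T.graph 0).tgt_inv, hLsrc]
  have hLmap : ∀ n e, (T.map n).onE (L (n + 1) e) = L n e := by
    intro n e
    refine hLuniq n ?_ ?_
    · rw [(T.map n).src_onE, hLsrc, hmap]
    · exact hLbase (n + 1) e
  have hVmap : ∀ n e, ZMod.castHom (pow_dvd_pow ℓ n.le_succ) (ZMod (ℓ ^ n)) (V (n + 1) e) =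
      V n e := by
    intro n e
    refine A.free n _ _ (s n ((T.graph 0).tgt e)) ?_
    rw [hV, ← hmap, ← A.map_onV, hV, ← (T.map n).tgt_onE, hLmap]
  -- Section and action are compatible with the tower maps, so the voltages of an edge form a point
  -- of the inverse limit ℤ_ℓ.
  choose α hα using fun e : S => PadicInt.exists_toZModPow_eq (fun n => V n e) fun n => hVmap n e
  have hext : ∀ n e, (T.graph 0).extend hS (voltage α n) e = V n e := by
    intro n e
    have h : ∀ e : S, voltage α n e = V n e := fun e => hα e n
    unfold extend
    split_ifs with he
    · exact h _
    · rw [h, hVinv, neg_neg]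
  refine ⟨α, fun n => ⟨fun x => (A.act n x.2).onV (s n x.1), fun e => (A.act n e.2).onE (L n e.1),
    fun e => ?_, fun e => ?_, fun e => ?_⟩, fun n => ⟨⟨?_, ?_⟩, ?_, ?_⟩, fun n => ?_, fun n => ?_⟩
  · rw [(A.act n _).src_onE, hLsrc]
    rfl
  · rw [(A.act n _).tgt_onE, ← hV, ← A.act_add_onV, ← hext]
    rfl
  · change (A.act n (e.2 + (T.graph 0).extend hS (voltage α n) e.1)).onE
      (L n ((T.graph 0).inv e.1)) = _
    rw [hext, hLinv, ← A.act_add_onE, add_neg_cancel_right, (A.act n _).onE_inv]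
  · rintro ⟨x, a⟩ ⟨y, b⟩ h
    change (A.act n a).onV (s n x) = (A.act n b).onV (s n y) at h
    have hxy : x = y := by
      rw [← hs n x, ← A.toBase_onV n a, h, A.toBase_onV, hs]
    subst hxy
    rw [A.free n a b _ h]
  · intro y
    obtain ⟨a, ha⟩ := A.transitive n (s n ((T.toBase n).onV y)) y (hs n _)
    exact ⟨((T.toBase n).onV y, a), ha⟩
  · rintro ⟨e, a⟩ ⟨e', b⟩ h
    change (A.act n a).onE (L n e) = (A.act n b).onE (L n e') at h
    have hee : e = e' := by
      rw [← hLbase n e, ← A.toBase_onE n a, h, A.toBase_onE, hLbase]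
    subst hee
    have h1 := congrArg (T.graph n).src h
    rw [(A.act n _).src_onE, (A.act n _).src_onE] at h1
    rw [A.free n a b _ h1]
  · intro e
    obtain ⟨a, ha⟩ := A.transitive n (s n ((T.toBase n).onV ((T.graph n).src e)))
      ((T.graph n).src e) (hs n _)
    refine ⟨((T.toBase n).onE e, a), (hT.galois n).1.eq_of_src_eq ?_ ?_⟩
    · change (T.graph n).src ((A.act n a).onE (L n ((T.toBase n).onE e))) = _
      rw [(A.act n _).src_onE, hLsrc, (T.toBase n).src_onE, ha]
    · exact (A.toBase_onE n a _).trans (hLbase n _)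
  · refine Hom.ext (funext fun x => ?_) (funext fun e => ?_)
    · exact (A.map_onV n x.2 _).trans (by rw [hmap]; rfl)
    · exact (A.map_onE n e.2 _).trans (by rw [hLmap]; rfl)
  · refine Hom.ext (funext fun x => ?_) (funext fun e => ?_)
    · exact (A.toBase_onV n x.2 _).trans (hs n _)
    · exact (A.toBase_onE n e.2 _).trans (hLbase n _)

end Tower

/-! ### Invariance under isomorphism and conclusion -/

namespace Hom

variable {X Y : Multigraph.{u, v}}

theorem isWalk_map (f : Hom Y X) {x y : Y.V} {w : List Y.E} (h : Y.IsWalk x w y) :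
    X.IsWalk (f.onV x) (w.map f.onE) (f.onV y) := by
  induction w generalizing x with
  | nil => exact congrArg f.onV h
  | cons e w ih =>
    refine ⟨by rw [f.src_onE, h.1], ?_⟩
    rw [f.tgt_onE]
    exact ih h.2

theorem IsIso.exists_inverse {f : Hom Y X} (hf : f.IsIso) :
    ∃ g : Hom X Y, g.IsIso ∧ f.comp g = Hom.id X ∧ g.comp f = Hom.id Y := by
  let eV := Equiv.ofBijective f.onV hf.1
  let eE := Equiv.ofBijective f.onE hf.2
  have hV : ∀ x, f.onV (eV.symm x) = x := eV.apply_symm_apply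
  have hE : ∀ e, f.onE (eE.symm e) = e := eE.apply_symm_apply
  let g : Hom X Y :=
    ⟨eV.symm, eE.symm, fun e => hf.1.1 (by rw [hV, ← f.src_onE, hE]),
      fun e => hf.1.1 (by rw [hV, ← f.tgt_onE, hE]),
      fun e => hf.2.1 (by rw [hE, f.onE_inv, hE])⟩
  exact ⟨g, ⟨eV.symm.bijective, eE.symm.bijective⟩, Hom.ext (funext hV) (funext hE),
    Hom.ext (funext eV.symm_apply_apply) (funext eE.symm_apply_apply)⟩

theorem IsIso.connectedOn_image {f : Hom Y X} (hf : f.IsIso) {F : Set Y.E}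
    (h : Y.ConnectedOn F) : X.ConnectedOn (f.onE '' F) := by
  refine ⟨h.1.map f.onV, fun x y => ?_⟩
  obtain ⟨x, rfl⟩ := hf.1.2 x
  obtain ⟨y, rfl⟩ := hf.1.2 y
  obtain ⟨w, hw, hwF⟩ := h.2 x y
  refine ⟨_, f.isWalk_map hw, fun e he => ?_⟩
  obtain ⟨e', he', rfl⟩ := List.mem_map.1 he
  exact ⟨e', hwF e' he', rfl⟩

theorem IsIso.connected {f : Hom Y X} (hf : f.IsIso) (h : Y.Connected) : X.Connected := by
  have := hf.connectedOn_image h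
  rwa [Set.image_univ, hf.2.2.range_eq] at this

theorem IsIso.acyclicOn_image {f : Hom Y X} (hf : f.IsIso) {F : Set Y.E}
    (h : Y.AcyclicOn F) : X.AcyclicOn (f.onE '' F) := by
  obtain ⟨g, -, -, hgf⟩ := hf.exists_inverse
  intro x w hw hr hwF
  have hgE : ∀ e, g.onE (f.onE e) = e := fun e => congrFun (congrArg Hom.onE hgf) e
  have hmem : ∀ e ∈ w.map g.onE, e ∈ F := by
    intro e he
    obtain ⟨e', he', rfl⟩ := List.mem_map.1 he
    obtain ⟨e'', he'', rfl⟩ := hwF e' he'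
    rwa [hgE]
  refine List.map_eq_nil_iff.1 (h (g.onV x) (w.map g.onE) (g.isWalk_map hw) ?_ hmem)
  refine (List.isChain_map _).2 (hr.imp fun a b hab hcon => hab ?_)
  obtain ⟨a, rfl⟩ := hf.2.2 a
  obtain ⟨b, rfl⟩ := hf.2.2 b
  rw [hgE, hgE] at hcon
  rw [hcon, f.onE_inv]

theorem IsIso.isSpanningTree_image {f : Hom Y X} (hf : f.IsIso) {F : Set Y.E}
    (h : Y.IsSpanningTree F) : X.IsSpanningTree (f.onE '' F) := by
  refine ⟨?_, hf.connectedOn_image h.2.1, hf.acyclicOn_image h.2.2⟩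
  rintro _ ⟨e, he, rfl⟩
  exact ⟨Y.inv e, h.1 e he, f.onE_inv e⟩

theorem IsIso.numSpanningTrees_le {f : Hom Y X} (hf : f.IsIso) :
    Y.numSpanningTrees ≤ X.numSpanningTrees :=
  Set.ncard_le_ncard_of_injOn (fun F => f.onE '' F) (fun _ => hf.isSpanningTree_image)
    (hf.2.1.image_injective.injOn) (Set.toFinite _)

theorem IsIso.numSpanningTrees_eq {f : Hom Y X} (hf : f.IsIso) :
    Y.numSpanningTrees = X.numSpanningTrees := by
  obtain ⟨g, hg, -, -⟩ := hf.exists_inverse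
  exact le_antisymm hf.numSpanningTrees_le hg.numSpanningTrees_le

end Hom

end Multigraph

theorem theoremA (ℓ p : ℕ) [Fact ℓ.Prime] [Fact p.Prime] (hℓp : ℓ ≠ p) :
    -- towers of derived multigraphs
    (∀ (X : Multigraph.{u, v}) (S : Set X.E) (hS : X.IsSection S) (α : S → ℤ_[ℓ]),
      (∀ n, ((X.derivedTower hS α).graph n).Connected) →
      GenPoly.Growth p (X.genPoly α)
        (fun n => ((X.derivedTower hS α).graph n).numSpanningTrees)) ∧
    -- arbitrary abelian towers: each of them is isomorphic to a tower of derived multigraphs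
    (∀ T : Multigraph.Tower.{u, v}, T.IsAbelian ℓ →
      ∀ (S : Set (T.graph 0).E) (hS : (T.graph 0).IsSection S),
        ∃ α : S → ℤ_[ℓ], T.IsoDerived hS α ∧
          GenPoly.Growth p ((T.graph 0).genPoly α) (fun n => (T.graph n).numSpanningTrees)) := by
  refine ⟨fun X S hS α h => Multigraph.growth_derivedTower hℓp hS α h, fun T hT S hS => ?_⟩
  obtain ⟨α, hα⟩ := hT.exists_isoDerived hS
  refine ⟨α, hα, ?_⟩
  obtain ⟨φ, hφ, -, -⟩ := hα
  -- Part (1) needs connected derived layers; connectedness is carried over by the inverse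
  -- isomorphisms.
  have hconn : ∀ n, (((T.graph 0).derivedTower hS α).graph n).Connected := fun n => by
    obtain ⟨g, hg, -, -⟩ := (hφ n).exists_inverse
    exact hg.connected (hT.connected n)
  have h := Multigraph.growth_derivedTower hℓp hS α hconn
  rwa [funext fun n => (hφ n).numSpanningTrees_eq] at h
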